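/- Let $M^3$ be a smooth $3$-manifold with an almost contact metric structure $(\varphi,\xi,\eta,g)$, i.e. $\varphi$ is a smooth $(1,1)$-tensor field, $\xi$ a smooth vector field, $\eta$ a smooth $1$-form and $g$ a Riemannian metric with $\varphi^2=-I+\eta\otimes\xi$, $\eta(\xi)=1$ and $g(\varphi X,\varphi Y)=g(X,Y)-\eta(X)\eta(Y)$. Assume that it is almost Kenmotsu, i.e. $d\eta=0$ and $d\Phi=2\eta\wedge\Phi$, where $\Phi(X,Y)=g(X,\varphi Y)$. Put $h=\tfrac12\mathcal L_\xi\varphi$, and suppose that there are smooth functions $k,\mu$ on $M$ such that the curvature $R_{XY}=[\nabla_X,\nabla_Y]-\nabla_{[X,Y]}$ of the Levi-Civita connection satisfies $$R_{XY}\xi=k\big(\eta(Y)X-\eta(X)Y\big)+\mu\big(\eta(Y)hX-\eta(X)hY\big)$$ for all vector fields $X,Y$ (that is, $M$ is an almost Kenmotsu generalized $(k,\mu)$-manifold). Suppose moreover that $dk\wedge\eta=0$ and $k<-1$ everywhere. Then every point $p\in M$ has an open neighbourhood $U$ on which there exist coordinates $x,y,z$ with $z<-1$ and a smooth orthonormal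 frame $(\xi,X,\varphi X)$ of eigenvectors of $h$, with $h\xi=0$, $hX=\lambda X$ and $h\varphi X=-\lambda\varphi X$ for $\lambda=\sqrt{-1-k}$, such that on $U$ one has $k=z$, $\mu$ is a smooth function of $z$ only, and $$X=\frac{\partial}{\partial x},\qquad \varphi X=\frac{\partial}{\partial y},\qquad \xi=a\frac{\partial}{\partial x}+b\frac{\partial}{\partial y}-4(z+1)\frac{\partial}{\partial z},$$ where $$a=x-\tfrac12\big(\mu+2\sqrt{-1-z}\big)\,y+f(z),\qquad b=y+\tfrac12\big(\mu-2\sqrt{-1-z}\big)\,x+r(z)$$ for some smooth functions $f,r$ of $z$ on the set of values of $z$ on $U$. -/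

import Mathlib

open Bundle Manifold VectorField
open scoped ContDiff

noncomputable section

namespace AlmostKenmotsu

/-! Throughout, `M` is a smooth `n`-manifold without boundary whose tangent bundle carries a smooth
Riemannian metric `g`, written `inner ℝ v w` on each tangent space. Vector fields are sections
`X : Π x : M, TangentSpace (𝓡 n) x`; identities between tensors are tested at each point `x` on
vector fields that are smooth near `x`. -/

section Forms

variable {n : ℕ} {M : Type*} [TopologicalSpace M] [ChartedSpace (EuclideanSpace ℝ (Fin n)) M]

/-- The derivative `X(f)` of a function `f` along a vector field `X`. -/
def dirDeriv (X : Π x : M, TangentSpace (𝓡 n) x) (f : M → ℝ) : M → ℝ :=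
  fun x ↦ mvfderiv (𝓡 n) f x (X x)

/-- The exterior derivative of a `1`-form:
`dη(X, Y) = X(η(Y)) - Y(η(X)) - η([X, Y])`. -/
def extDerivOne (η : Π x : M, TangentSpace (𝓡 n) x →L[ℝ] ℝ)
    (X Y : Π x : M, TangentSpace (𝓡 n) x) (x : M) : ℝ :=
  dirDeriv X (fun y ↦ η y (Y y)) x - dirDeriv Y (fun y ↦ η y (X y)) x
    - η x (mlieBracket (𝓡 n) X Y x)

/-- The exterior derivative of a `2`-form: `dΦ(X, Y, Z)` is the cyclic sum of
`X(Φ(Y, Z)) - Φ([X, Y], Z)`. -/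
def extDerivTwo (Φ : Π x : M, TangentSpace (𝓡 n) x → TangentSpace (𝓡 n) x → ℝ)
    (X Y Z : Π x : M, TangentSpace (𝓡 n) x) (x : M) : ℝ :=
  dirDeriv X (fun y ↦ Φ y (Y y) (Z y)) x + dirDeriv Y (fun y ↦ Φ y (Z y) (X y)) x
    + dirDeriv Z (fun y ↦ Φ y (X y) (Y y)) x
    - Φ x (mlieBracket (𝓡 n) X Y x) (Z x) - Φ x (mlieBracket (𝓡 n) Y Z x) (X x)
    - Φ x (mlieBracket (𝓡 n) Z X x) (Y x)

/-- The wedge product of a covector and a `2`-form at a point, in the normalization that goes with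
`extDerivTwo`. -/
def wedgeOneTwo {V : Type*} (η : V → ℝ) (Φ : V → V → ℝ) (u v w : V) : ℝ :=
  η u * Φ v w + η v * Φ w u + η w * Φ u v

/-- The wedge product of two covectors at a point. -/
def wedgeOneOne {V : Type*} (α β : V → ℝ) (u v : V) : ℝ :=
  α u * β v - α v * β u

/-- The tensor field `h = (1/2) ℒ_ξ φ` applied to a vector field:
`hX = (1/2) ([ξ, φX] - φ[ξ, X])`. -/
def hTensor (φ : Π x : M, TangentSpace (𝓡 n) x →L[ℝ] TangentSpace (𝓡 n) x)
    (ξ X : Π x : M, TangentSpace (𝓡 n) x) : Π x : M, TangentSpace (𝓡 n) x :=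
  fun x ↦ (1 / 2 : ℝ) •
    (mlieBracket (𝓡 n) ξ (fun y ↦ φ y (X y)) x - φ x (mlieBracket (𝓡 n) ξ X x))

/-- The coordinate vector field `∂/∂xᵢ` of the chart `e`, on the domain of `e`. -/
def coordField (e : OpenPartialHomeomorph M (EuclideanSpace ℝ (Fin n))) (i : Fin n) (x : M) :
    TangentSpace (𝓡 n) x :=
  mfderiv (𝓡 n) (𝓡 n) e.symm (e x) (EuclideanSpace.single i (1 : ℝ))

end Forms

section Structures

variable {n : ℕ} {M : Type*} [TopologicalSpace M] [ChartedSpace (EuclideanSpace ℝ (Fin n)) M]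
  [IsManifold (𝓡 n) ∞ M]

/-- A vector field is smooth near the point `x`. -/
def SmoothAt (X : Π x : M, TangentSpace (𝓡 n) x) (x : M) : Prop :=
  ContMDiffAt (𝓡 n) (𝓡 n).tangent ∞ (fun y ↦ (⟨y, X y⟩ : TangentBundle (𝓡 n) M)) x

/-- The curvature `R_{XY} Z = ∇_X ∇_Y Z - ∇_Y ∇_X Z - ∇_{[X,Y]} Z` of a connection on the tangent
bundle; `D Z x (X x)` is the value of `∇_X Z` at `x`. -/
def curvature (D : CovariantDerivative (𝓡 n) (EuclideanSpace ℝ (Fin n))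
      (fun x : M ↦ TangentSpace (𝓡 n) x))
    (X Y Z : Π x : M, TangentSpace (𝓡 n) x) (x : M) : TangentSpace (𝓡 n) x :=
  D (fun y ↦ D Z y (Y y)) x (X x) - D (fun y ↦ D Z y (X y)) x (Y x)
    - D Z x (mlieBracket (𝓡 n) X Y x)

variable [RiemannianBundle (fun x : M ↦ TangentSpace (𝓡 n) x)]
  [IsContMDiffRiemannianBundle (𝓡 n) ∞ (EuclideanSpace ℝ (Fin n))
    (fun x : M ↦ TangentSpace (𝓡 n) x)]

/-- A smooth Riemannian metric is in particular of class `C¹`. -/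
instance isContMDiffRiemannianBundle_one :
    IsContMDiffRiemannianBundle (𝓡 n) 1 (EuclideanSpace ℝ (Fin n))
      (fun x : M ↦ TangentSpace (𝓡 n) x) :=
  IsContMDiffRiemannianBundle.of_le (n := ∞) (by exact_mod_cast le_top)

/-- `D` is the Levi-Civita connection of the metric: it is torsion-free and metric. -/
structure IsLeviCivita (D : CovariantDerivative (𝓡 n) (EuclideanSpace ℝ (Fin n))
    (fun x : M ↦ TangentSpace (𝓡 n) x)) : Prop where
  torsion_eq_zero : D.torsion = 0
  metric : D.IsMetricCompatible

/-- The fundamental `2`-form `Φ(X, Y) = g(X, φY)`. -/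
def fundForm (φ : Π x : M, TangentSpace (𝓡 n) x →L[ℝ] TangentSpace (𝓡 n) x) (x : M)
    (v w : TangentSpace (𝓡 n) x) : ℝ :=
  inner ℝ v (φ x w)

/-- `(φ, ξ, η, g)` is an almost contact metric structure on `M`. -/
structure IsAlmostContactMetric
    (φ : Π x : M, TangentSpace (𝓡 n) x →L[ℝ] TangentSpace (𝓡 n) x)
    (ξ : Π x : M, TangentSpace (𝓡 n) x)
    (η : Π x : M, TangentSpace (𝓡 n) x →L[ℝ] ℝ) : Prop where
  smooth_phi : ContMDiff (𝓡 n)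
    ((𝓡 n).prod 𝓘(ℝ, EuclideanSpace ℝ (Fin n) →L[ℝ] EuclideanSpace ℝ (Fin n))) ∞
    (fun x ↦ TotalSpace.mk' (EuclideanSpace ℝ (Fin n) →L[ℝ] EuclideanSpace ℝ (Fin n))
      (E := fun x : M ↦ TangentSpace (𝓡 n) x →L[ℝ] TangentSpace (𝓡 n) x) x (φ x))
  smooth_xi : ∀ x, SmoothAt ξ x
  smooth_eta : ContMDiff (𝓡 n) ((𝓡 n).prod 𝓘(ℝ, EuclideanSpace ℝ (Fin n) →L[ℝ] ℝ)) ∞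
    (fun x ↦ TotalSpace.mk' (EuclideanSpace ℝ (Fin n) →L[ℝ] ℝ)
      (E := fun x : M ↦ TangentSpace (𝓡 n) x →L[ℝ] ℝ) x (η x))
  phi_sq : ∀ x (v : TangentSpace (𝓡 n) x), φ x (φ x v) = -v + η x v • ξ x
  eta_xi : ∀ x, η x (ξ x) = 1
  compatible : ∀ x (v w : TangentSpace (𝓡 n) x),
    inner ℝ (φ x v) (φ x w) = inner ℝ v w - η x v * η x w

/-- `(M, φ, ξ, η, g)` is an almost Kenmotsu manifold: an almost contact metric manifold with
`dη = 0` and `dΦ = 2 η ∧ Φ`. -/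
structure IsAlmostKenmotsu
    (φ : Π x : M, TangentSpace (𝓡 n) x →L[ℝ] TangentSpace (𝓡 n) x)
    (ξ : Π x : M, TangentSpace (𝓡 n) x)
    (η : Π x : M, TangentSpace (𝓡 n) x →L[ℝ] ℝ) : Prop
    extends IsAlmostContactMetric φ ξ η where
  eta_closed : ∀ (x : M) (X Y : Π x : M, TangentSpace (𝓡 n) x), SmoothAt X x → SmoothAt Y x →
    extDerivOne η X Y x = 0
  d_fundForm : ∀ (x : M) (X Y Z : Π x : M, TangentSpace (𝓡 n) x),
    SmoothAt X x → SmoothAt Y x → SmoothAt Z x →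
    extDerivTwo (fundForm φ) X Y Z x = 2 * wedgeOneTwo (η x) (fundForm φ x) (X x) (Y x) (Z x)

/-- The generalized `(k, μ)`-nullity condition for smooth functions `k`, `μ`: the curvature of the
Levi-Civita connection satisfies
`R_{XY} ξ = k (η(Y) X - η(X) Y) + μ (η(Y) hX - η(X) hY)` for all vector fields `X`, `Y`.
The Levi-Civita connection exists and its values on differentiable vector fields are unique, so
`∃ D, IsLeviCivita D ∧ …` refers to that one connection. -/
structure IsGeneralizedKMu
    (φ : Π x : M, TangentSpace (𝓡 n) x →L[ℝ] TangentSpace (𝓡 n) x)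
    (ξ : Π x : M, TangentSpace (𝓡 n) x)
    (η : Π x : M, TangentSpace (𝓡 n) x →L[ℝ] ℝ) (k μ : M → ℝ) : Prop where
  smooth_k : ContMDiff (𝓡 n) 𝓘(ℝ, ℝ) ∞ k
  smooth_mu : ContMDiff (𝓡 n) 𝓘(ℝ, ℝ) ∞ μ
  nullity : ∃ D : CovariantDerivative (𝓡 n) (EuclideanSpace ℝ (Fin n))
      (fun x : M ↦ TangentSpace (𝓡 n) x), IsLeviCivita D ∧
    ∀ (x : M) (X Y : Π x : M, TangentSpace (𝓡 n) x), SmoothAt X x → SmoothAt Y x →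
      curvature D X Y ξ x = k x • (η x (Y x) • X x - η x (X x) • Y x)
        + μ x • (η x (Y x) • hTensor φ ξ X x - η x (X x) • hTensor φ ξ Y x)

end Structures

end AlmostKenmotsu

end

/-! Near a point the geometry is read off an orthonormal frame `(e, φ e, ξ)`. Closedness of `η`
makes every bracket of frame fields horizontal, and `dΦ = 2η ∧ Φ` gives bracketing with `ξ` trace
`-2` on `ker η`. What is left of `[ξ, e]` and `[ξ, φ e]` is two components of `h` and the rotation
speed of the frame along `ξ`. The Koszul computation (`connection`) then turns the nullity condition
into scalar equations.

The equations for `R(·, ξ)ξ` (`nullity_xi`) say that `h² = -1 - k` on `ker η`. As `k < -1`, there is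
a smooth unit eigenvector field `X` with eigenvalue `λ = √(-1 - k) > 0` (`exists_eigenframe`). In
this eigenframe they also give `ξ(λ) = -2λ`, hence `ξ(k) = -4(k + 1)`, and rotation speed `-μ/2`.
Since `dk ∧ η = 0`, `λ` has no horizontal derivative, and `R(X, φX)ξ = 0` forces `[X, φX] = 0`
(`structure_equations`). The Jacobi identity then kills the horizontal derivatives of `μ`
(`mvfderiv_mu_eq_zero`), so `μ` is locally a function of `k`, whose differential never vanishes.

For the coordinates, `X` and `φX` commute but `ξ` commutes with neither in general. For functions
`P`, `Q` of `k`, the `1`-form with values `P`, `Q`, `0` on `X`, `φX`, `ξ` is closed as soon as `(P,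
Q)` solves a planar linear ODE in `k`. Two independent solutions give, by the Poincaré lemma, two
first integrals `w₀`, `w₁` of `ξ` (`exists_primitive`). Solving `Pᵢ x + Qᵢ y = wᵢ` yields `x`, `y`
dual to `X`, `φX` (`exists_leaf_coordinates`). With `z = k` they form a chart, and differentiating
the linear system along `ξ` produces the coefficients `a`, `b`, even with `f = r = 0`. -/

noncomputable section

namespace AlmostKenmotsu

/-! ### Pointwise algebra of an almost contact metric structure -/

section Pointwise

variable {M : Type*} [TopologicalSpace M] [ChartedSpace (EuclideanSpace ℝ (Fin 3)) M]
  [IsManifold (𝓡 3) ∞ M]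
  [RiemannianBundle (fun x : M ↦ TangentSpace (𝓡 3) x)]
  {φ : Π x : M, TangentSpace (𝓡 3) x →L[ℝ] TangentSpace (𝓡 3) x}
  {ξ : Π x : M, TangentSpace (𝓡 3) x}
  {η : Π x : M, TangentSpace (𝓡 3) x →L[ℝ] ℝ}

namespace IsAlmostContactMetric

theorem xi_ne_zero (hM : IsAlmostContactMetric φ ξ η) (x : M) : ξ x ≠ 0 := by
  intro h
  simpa [h] using hM.eta_xi x

theorem phi_xi (hM : IsAlmostContactMetric φ ξ η) (x : M) : φ x (ξ x) = 0 := by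
  have h0 : φ x (φ x (ξ x)) = 0 := by simp [hM.phi_sq, hM.eta_xi]
  have h1 := hM.phi_sq x (φ x (ξ x))
  rw [h0, map_zero] at h1
  have h2 : φ x (ξ x) = η x (φ x (ξ x)) • ξ x := by
    rw [eq_comm, neg_add_eq_zero] at h1; exact h1
  -- If `φ ξ = c ξ` then `φ² ξ = c² ξ`; but `φ² ξ = -ξ + ξ = 0`, so `c = 0`.
  have h3 : (η x (φ x (ξ x)) * η x (φ x (ξ x))) • ξ x = 0 := by
    rw [mul_smul, ← h2, ← map_smul, ← h2, h0]
  rcases smul_eq_zero.1 h3 with h | h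
  · rw [h2, mul_self_eq_zero.1 h, zero_smul]
  · exact absurd h (hM.xi_ne_zero x)

/-- Evaluating `φ³ v` as `φ²(φ v)` and as `φ(φ² v)` gives results that differ by `η(φ v) ξ`. -/
theorem eta_phi (hM : IsAlmostContactMetric φ ξ η) (x : M) (v : TangentSpace (𝓡 3) x) :
    η x (φ x v) = 0 := by
  have h1 := hM.phi_sq x (φ x v)
  rw [hM.phi_sq x v, map_add, map_neg, map_smul, hM.phi_xi, smul_zero, add_zero] at h1
  simpa [hM.xi_ne_zero] using h1

theorem inner_xi (hM : IsAlmostContactMetric φ ξ η) (x : M) (v : TangentSpace (𝓡 3) x) :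
    inner ℝ v (ξ x) = η x v := by
  have := hM.compatible x v (ξ x)
  rw [hM.phi_xi, inner_zero_right, hM.eta_xi] at this
  linarith

theorem inner_phi_self (hM : IsAlmostContactMetric φ ξ η) (x : M) (v : TangentSpace (𝓡 3) x) :
    inner ℝ v (φ x v) = 0 := by
  have := hM.compatible x v (φ x v)
  rw [hM.phi_sq, hM.eta_phi, inner_add_right, inner_smul_right, hM.inner_xi, hM.eta_phi,
    inner_neg_right, real_inner_comm] at this
  linarith

theorem phi_phi (hM : IsAlmostContactMetric φ ξ η) {x : M} {v : TangentSpace (𝓡 3) x}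
    (hv : η x v = 0) : φ x (φ x v) = -v := by
  rw [hM.phi_sq, hv, zero_smul, add_zero]

theorem orthonormal (hM : IsAlmostContactMetric φ ξ η) {x : M} {v : TangentSpace (𝓡 3) x}
    (hv : η x v = 0) (hv1 : inner ℝ v v = (1 : ℝ)) : Orthonormal ℝ ![ξ x, v, φ x v] := by
  have hφ : inner ℝ (φ x v) (φ x v) = (1 : ℝ) := by rw [hM.compatible, hv, hv1]; simp
  have hξ : inner ℝ (ξ x) (ξ x) = (1 : ℝ) := by rw [hM.inner_xi, hM.eta_xi]
  have h1 : inner ℝ (ξ x) v = (0 : ℝ) := by rw [real_inner_comm, hM.inner_xi, hv]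
  have h2 : inner ℝ (ξ x) (φ x v) = (0 : ℝ) := by rw [real_inner_comm, hM.inner_xi, hM.eta_phi]
  have h3 := hM.inner_phi_self x v
  rw [orthonormal_iff_ite]
  intro i j
  fin_cases i <;> fin_cases j <;>
    simp [hφ, hξ, h1, h2, h3, hv1, real_inner_comm, hM.inner_xi, hM.eta_phi, hv,
      -inner_self_eq_norm_sq_to_K]

theorem expand (hM : IsAlmostContactMetric φ ξ η) {x : M} {v : TangentSpace (𝓡 3) x}
    (hv : η x v = 0) (hv1 : inner ℝ v v = (1 : ℝ)) (w : TangentSpace (𝓡 3) x) :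
    w = (inner ℝ v w : ℝ) • v + (inner ℝ (φ x v) w : ℝ) • φ x v + η x w • ξ x := by
  have ho := hM.orthonormal hv hv1
  have hr : Module.finrank ℝ (TangentSpace (𝓡 3) x) = 3 := by
    change Module.finrank ℝ (EuclideanSpace ℝ (Fin 3)) = 3
    simp
  have : FiniteDimensional ℝ (TangentSpace (𝓡 3) x) := Module.finite_of_finrank_pos (by omega)
  let b := basisOfOrthonormalOfCardEqFinrank ho (by simp [hr])
  let B := b.toOrthonormalBasis (by simpa [b] using ho)
  have hB := B.sum_repr' w
  rw [Fin.sum_univ_three] at hB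
  simp only [B, b, Module.Basis.coe_toOrthonormalBasis, coe_basisOfOrthonormalOfCardEqFinrank,
    Matrix.cons_val] at hB
  rw [real_inner_comm, hM.inner_xi] at hB
  nth_rw 1 [← hB]
  abel

theorem frame_ext (hM : IsAlmostContactMetric φ ξ η) {x : M} {v : TangentSpace (𝓡 3) x}
    (hv : η x v = 0) (hv1 : inner ℝ v v = (1 : ℝ)) {w w' : TangentSpace (𝓡 3) x}
    (h1 : inner ℝ v w = (inner ℝ v w' : ℝ)) (h2 : inner ℝ (φ x v) w = (inner ℝ (φ x v) w' : ℝ))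
    (h3 : η x w = η x w') : w = w' := by
  rw [hM.expand hv hv1 w, hM.expand hv hv1 w', h1, h2, h3]

end IsAlmostContactMetric
end Pointwise

/-! ### Smoothness of fields built from smooth fields -/

section Smooth

open Filter Topology

variable {M : Type*} [TopologicalSpace M] [ChartedSpace (EuclideanSpace ℝ (Fin 3)) M]
  [IsManifold (𝓡 3) ∞ M]

theorem SmoothAt.mdiff {X : Π x : M, TangentSpace (𝓡 3) x} {x : M} (hX : SmoothAt X x) :
    MDifferentiableAt (𝓡 3) (𝓡 3).tangent (fun y ↦ (⟨y, X y⟩ : TangentBundle (𝓡 3) M)) x :=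
  ContMDiffAt.mdifferentiableAt hX (by simp)

theorem SmoothAt.congr {X Y : Π x : M, TangentSpace (𝓡 3) x} {x : M} (hX : SmoothAt X x)
    (h : Y =ᶠ[𝓝 x] X) : SmoothAt Y x :=
  ContMDiffAt.congr_of_eventuallyEq hX (h.mono fun y hy ↦ by simp [hy])

theorem SmoothAt.add {X Y : Π x : M, TangentSpace (𝓡 3) x} {x : M} (hX : SmoothAt X x)
    (hY : SmoothAt Y x) : SmoothAt (fun y ↦ X y + Y y) x :=
  ContMDiffAt.add_section hX hY

theorem SmoothAt.smul {f : M → ℝ} {X : Π x : M, TangentSpace (𝓡 3) x} {x : M}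
    (hf : ContMDiffAt (𝓡 3) 𝓘(ℝ, ℝ) ∞ f x) (hX : SmoothAt X x) :
    SmoothAt (fun y ↦ f y • X y) x :=
  ContMDiffAt.smul_section hf hX

theorem SmoothAt.mlieBracket {X Y : Π x : M, TangentSpace (𝓡 3) x} {x : M} (hX : SmoothAt X x)
    (hY : SmoothAt Y x) : SmoothAt (mlieBracket (𝓡 3) X Y) x := by
  have : IsManifold (𝓡 3) (minSmoothness ℝ 2) M :=
    IsManifold.of_le (n := ∞) (by rw [minSmoothness_of_isRCLikeNormedField]; exact WithTop.coe_le_coe.2 (le_top : (2 : ℕ∞) ≤ ⊤))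
  have : IsManifold (𝓡 3) (minSmoothness ℝ 3) M :=
    IsManifold.of_le (n := ∞) (by rw [minSmoothness_of_isRCLikeNormedField]; exact WithTop.coe_le_coe.2 (le_top : (3 : ℕ∞) ≤ ⊤))
  have : IsManifold (𝓡 3) ((⊤ : ℕ∞) + 1) M := IsManifold.of_le (n := ∞) (by simp)
  exact ContMDiffAt.mlieBracket_vectorField (m := ⊤) (n := ⊤) hX hY (by simp)

theorem SmoothAt.clm_apply {ψ : Π x : M, TangentSpace (𝓡 3) x →L[ℝ] TangentSpace (𝓡 3) x}
    {X : Π x : M, TangentSpace (𝓡 3) x}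
    (hψ : ContMDiff (𝓡 3)
    ((𝓡 3).prod 𝓘(ℝ, EuclideanSpace ℝ (Fin 3) →L[ℝ] EuclideanSpace ℝ (Fin 3))) ∞
    (fun x ↦ TotalSpace.mk' (EuclideanSpace ℝ (Fin 3) →L[ℝ] EuclideanSpace ℝ (Fin 3))
      (E := fun x : M ↦ TangentSpace (𝓡 3) x →L[ℝ] TangentSpace (𝓡 3) x) x (ψ x)))
    {x : M} (hX : SmoothAt X x) : SmoothAt (fun y ↦ ψ y (X y)) x :=
  ContMDiffAt.clm_bundle_apply (hψ x) hX

variable [RiemannianBundle (fun x : M ↦ TangentSpace (𝓡 3) x)]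
  [IsContMDiffRiemannianBundle (𝓡 3) ∞ (EuclideanSpace ℝ (Fin 3))
    (fun x : M ↦ TangentSpace (𝓡 3) x)]

theorem SmoothAt.inner {X Y : Π x : M, TangentSpace (𝓡 3) x} {x : M} (hX : SmoothAt X x)
    (hY : SmoothAt Y x) : ContMDiffAt (𝓡 3) 𝓘(ℝ, ℝ) ∞ (fun y ↦ (inner ℝ (X y) (Y y) : ℝ)) x :=
  ContMDiffAt.inner_bundle hX hY

end Smooth

/-! ### Covariant derivatives of local combinations of fields -/

section Connection

open Filter Topology

variable {M : Type*} [TopologicalSpace M] [ChartedSpace (EuclideanSpace ℝ (Fin 3)) M]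
  [IsManifold (𝓡 3) ∞ M]

theorem covariantDerivative_combination
    (D : CovariantDerivative (𝓡 3) (EuclideanSpace ℝ (Fin 3)) (fun x : M ↦ TangentSpace (𝓡 3) x))
    {σ X Y : Π x : M, TangentSpace (𝓡 3) x} {f g : M → ℝ} {x : M} (hX : SmoothAt X x)
    (hY : SmoothAt Y x) (hf : ContMDiffAt (𝓡 3) 𝓘(ℝ, ℝ) ∞ f x)
    (hg : ContMDiffAt (𝓡 3) 𝓘(ℝ, ℝ) ∞ g x)
    (h : ∀ᶠ y in 𝓝 x, σ y = f y • X y + g y • Y y) (v : TangentSpace (𝓡 3) x) :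
    D σ x v = f x • D X x v + mvfderiv (𝓡 3) f x v • X x
      + (g x • D Y x v + mvfderiv (𝓡 3) g x v • Y x) := by
  have hfX := hX.smul hf
  have hgY := hY.smul hg
  have hs := hfX.add hgY
  have hD := D.isCovariantDerivativeOnUniv
  rw [hD.congr_of_eventuallyEq (hs.congr h).mdiff hs.mdiff univ_mem h]
  have h1 := hD.add hfX.mdiff hgY.mdiff
  have h2 := hD.leibniz hX.mdiff (hf.mdifferentiableAt (by simp))
  have h3 := hD.leibniz hY.mdiff (hg.mdifferentiableAt (by simp))
  change D.toFun ((f • X) + (g • Y)) x v = _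
  rw [hD.add (σ := f • X) (σ' := g • Y) hfX.mdiff hgY.mdiff, h2, h3]
  simp

omit [IsManifold (𝓡 3) ∞ M] in
theorem mvfderiv_eq_zero_of_eventually_const {f : M → ℝ} {x : M} {c : ℝ}
    (h : ∀ᶠ y in 𝓝 x, f y = c) : mvfderiv (𝓡 3) f x = 0 := by
  have : f =ᶠ[𝓝 x] fun _ ↦ c := h
  rw [mvfderiv, this.mfderiv_eq, mfderiv_const]
  rfl

end Connection

/-! ### Brackets and the tensor `h` in a horizontal frame -/

section Frame

open Filter Topology

variable {M : Type*} [TopologicalSpace M] [ChartedSpace (EuclideanSpace ℝ (Fin 3)) M]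
  [IsManifold (𝓡 3) ∞ M]
  [RiemannianBundle (fun x : M ↦ TangentSpace (𝓡 3) x)]
  {φ : Π x : M, TangentSpace (𝓡 3) x →L[ℝ] TangentSpace (𝓡 3) x}
  {ξ : Π x : M, TangentSpace (𝓡 3) x}
  {η : Π x : M, TangentSpace (𝓡 3) x →L[ℝ] ℝ}

/-- `e` is a smooth unit section of `ker η` over the open set `U`, so that `(e, φ e, ξ)` is an
orthonormal frame there. -/
structure IsUnitHorizontal (η : Π x : M, TangentSpace (𝓡 3) x →L[ℝ] ℝ)
    (e : Π x : M, TangentSpace (𝓡 3) x) (U : Set M) : Prop where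
  isOpen : IsOpen U
  smooth : ∀ q ∈ U, SmoothAt e q
  eta : ∀ q ∈ U, η q (e q) = 0
  unit : ∀ q ∈ U, inner ℝ (e q) (e q) = (1 : ℝ)

/-- The field `φ e`. -/
abbrev phiField (φ : Π x : M, TangentSpace (𝓡 3) x →L[ℝ] TangentSpace (𝓡 3) x)
    (e : Π x : M, TangentSpace (𝓡 3) x) : Π x : M, TangentSpace (𝓡 3) x := fun x ↦ φ x (e x)

/-- The component of `h e` along `e`. -/
def hDiag (φ : Π x : M, TangentSpace (𝓡 3) x →L[ℝ] TangentSpace (𝓡 3) x)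
    (ξ e : Π x : M, TangentSpace (𝓡 3) x) (x : M) : ℝ :=
  (1 / 2) * (inner ℝ (φ x (e x)) (mlieBracket (𝓡 3) ξ e x)
    + inner ℝ (e x) (mlieBracket (𝓡 3) ξ (phiField φ e) x))

/-- The component of `h e` along `φ e`. -/
def hOff (φ : Π x : M, TangentSpace (𝓡 3) x →L[ℝ] TangentSpace (𝓡 3) x)
    (ξ e : Π x : M, TangentSpace (𝓡 3) x) (x : M) : ℝ :=
  (1 / 2) * (inner ℝ (φ x (e x)) (mlieBracket (𝓡 3) ξ (phiField φ e) x)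
    - inner ℝ (e x) (mlieBracket (𝓡 3) ξ e x))

/-- The rotation speed `g(∇_ξ e, φ e)` of the frame along `ξ`. -/
def frameRot (φ : Π x : M, TangentSpace (𝓡 3) x →L[ℝ] TangentSpace (𝓡 3) x)
    (ξ e : Π x : M, TangentSpace (𝓡 3) x) (x : M) : ℝ :=
  (1 / 2) * (inner ℝ (φ x (e x)) (mlieBracket (𝓡 3) ξ e x)
    - inner ℝ (e x) (mlieBracket (𝓡 3) ξ (phiField φ e) x))

namespace IsUnitHorizontal

variable {e : Π x : M, TangentSpace (𝓡 3) x} {U : Set M} {q : M}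

theorem eventually_mem (he : IsUnitHorizontal η e U) (hq : q ∈ U) : ∀ᶠ y in 𝓝 q, y ∈ U :=
  he.isOpen.mem_nhds hq

theorem smooth_phi (he : IsUnitHorizontal η e U) (hM : IsAlmostContactMetric φ ξ η) (hq : q ∈ U) :
    SmoothAt (phiField φ e) q :=
  (he.smooth q hq).clm_apply hM.smooth_phi

/-- In `dη(X, Y) = 0` the two derivative terms differentiate constants, so only `η([X, Y])`
survives. -/
theorem eta_mlieBracket (hM : IsAlmostKenmotsu φ ξ η) {X Y : Π x : M, TangentSpace (𝓡 3) x}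
    {c d : ℝ} (hX : SmoothAt X q) (hY : SmoothAt Y q)
    (hcX : ∀ᶠ y in 𝓝 q, η y (X y) = c) (hcY : ∀ᶠ y in 𝓝 q, η y (Y y) = d) :
    η q (mlieBracket (𝓡 3) X Y q) = 0 := by
  have := hM.eta_closed q X Y hX hY
  simp only [extDerivOne, dirDeriv, mvfderiv_eq_zero_of_eventually_const hcX,
    mvfderiv_eq_zero_of_eventually_const hcY] at this
  simpa using this

theorem eta_bracket_xi (he : IsUnitHorizontal η e U) (hM : IsAlmostKenmotsu φ ξ η) (hq : q ∈ U) :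
    η q (mlieBracket (𝓡 3) ξ e q) = 0 :=
  eta_mlieBracket hM (hM.smooth_xi q) (he.smooth q hq) (Eventually.of_forall hM.eta_xi)
    ((he.eventually_mem hq).mono he.eta)

theorem eta_bracket_xi_phi (he : IsUnitHorizontal η e U) (hM : IsAlmostKenmotsu φ ξ η)
    (hq : q ∈ U) : η q (mlieBracket (𝓡 3) ξ (phiField φ e) q) = 0 :=
  eta_mlieBracket hM (hM.smooth_xi q) (he.smooth_phi hM.toIsAlmostContactMetric hq)
    (Eventually.of_forall hM.eta_xi) (Eventually.of_forall fun y ↦ hM.eta_phi y _)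

theorem eta_bracket (he : IsUnitHorizontal η e U) (hM : IsAlmostKenmotsu φ ξ η)
    (hq : q ∈ U) : η q (mlieBracket (𝓡 3) e (phiField φ e) q) = 0 :=
  eta_mlieBracket hM (he.smooth q hq) (he.smooth_phi hM.toIsAlmostContactMetric hq)
    ((he.eventually_mem hq).mono he.eta) (Eventually.of_forall fun y ↦ hM.eta_phi y _)

theorem phi_phi (he : IsUnitHorizontal η e U) (hM : IsAlmostContactMetric φ ξ η) (hq : q ∈ U) :
    φ q (φ q (e q)) = -e q := hM.phi_phi (he.eta q hq)

theorem unit_phi (he : IsUnitHorizontal η e U) (hM : IsAlmostContactMetric φ ξ η) (hq : q ∈ U) :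
    inner ℝ (φ q (e q)) (φ q (e q)) = (1 : ℝ) := by
  rw [hM.compatible, he.eta q hq, he.unit q hq]; simp

/-- This is `dΦ = 2η ∧ Φ` evaluated on `(ξ, e, φ e)`. The values of `Φ` on the frame are the
constants `-1, 0, 0`, so only bracket terms remain on the left. -/
theorem trace_bracket (he : IsUnitHorizontal η e U) (hM : IsAlmostKenmotsu φ ξ η) (hq : q ∈ U) :
    inner ℝ (e q) (mlieBracket (𝓡 3) ξ e q)
      + inner ℝ (φ q (e q)) (mlieBracket (𝓡 3) ξ (phiField φ e) q) = (-2 : ℝ) := by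
  have hC := hM.toIsAlmostContactMetric
  have h := hM.d_fundForm q ξ e (phiField φ e) (hM.smooth_xi q) (he.smooth q hq)
    (he.smooth_phi hC hq)
  have c1 : ∀ᶠ y in 𝓝 q, fundForm φ y (e y) (phiField φ e y) = -1 := by
    filter_upwards [he.eventually_mem hq] with y hy
    rw [fundForm, phiField, he.phi_phi hC hy, inner_neg_right, he.unit y hy]
  have c2 : ∀ᶠ y in 𝓝 q, fundForm φ y (phiField φ e y) (ξ y) = 0 := by
    filter_upwards with y
    rw [fundForm, hC.phi_xi, inner_zero_right]
  have c3 : ∀ᶠ y in 𝓝 q, fundForm φ y (ξ y) (e y) = 0 := by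
    filter_upwards with y
    rw [fundForm, real_inner_comm, hC.inner_xi, hC.eta_phi]
  simp only [extDerivTwo, dirDeriv, mvfderiv_eq_zero_of_eventually_const c1,
    mvfderiv_eq_zero_of_eventually_const c2, mvfderiv_eq_zero_of_eventually_const c3, wedgeOneTwo,
    c1.self_of_nhds, c2.self_of_nhds, c3.self_of_nhds, hM.eta_xi] at h
  simp only [fundForm, hC.phi_xi, phiField, he.phi_phi hC hq, inner_zero_right, inner_neg_right,
    zero_apply] at h
  rw [mlieBracket_swap_apply (V := fun x ↦ φ x (e x)), inner_neg_left,
    real_inner_comm (mlieBracket (𝓡 3) ξ e q), real_inner_comm (φ q (e q))] at *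
  linarith

/-- The brackets `[ξ, e]` and `[ξ, φ e]` have four horizontal components in all. The trace relation
removes one, and `hDiag`, `hOff`, `frameRot` parametrize the other three. -/
theorem bracket_xi (he : IsUnitHorizontal η e U) (hM : IsAlmostKenmotsu φ ξ η) (hq : q ∈ U) :
    mlieBracket (𝓡 3) ξ e q = (-1 - hOff φ ξ e q) • e q
      + (hDiag φ ξ e q + frameRot φ ξ e q) • φ q (e q) := by
  have hC := hM.toIsAlmostContactMetric
  have h := hC.expand (he.eta q hq) (he.unit q hq) (mlieBracket (𝓡 3) ξ e q)
  have t := he.trace_bracket hM hq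
  rw [he.eta_bracket_xi hM hq, zero_smul, add_zero] at h
  rw [h]
  congr 2
  · rw [hOff]; linarith
  · rw [hDiag, frameRot]; ring

theorem bracket_xi_phi (he : IsUnitHorizontal η e U) (hM : IsAlmostKenmotsu φ ξ η) (hq : q ∈ U) :
    mlieBracket (𝓡 3) ξ (phiField φ e) q = (hDiag φ ξ e q - frameRot φ ξ e q) • e q
      + (hOff φ ξ e q - 1) • φ q (e q) := by
  have hC := hM.toIsAlmostContactMetric
  have h := hC.expand (he.eta q hq) (he.unit q hq) (mlieBracket (𝓡 3) ξ (phiField φ e) q)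
  have t := he.trace_bracket hM hq
  rw [he.eta_bracket_xi_phi hM hq, zero_smul, add_zero] at h
  rw [h]
  congr 2
  · rw [hDiag, frameRot]; ring
  · rw [hOff]; linarith

theorem bracket_phi (he : IsUnitHorizontal η e U) (hM : IsAlmostKenmotsu φ ξ η) (hq : q ∈ U) :
    mlieBracket (𝓡 3) e (phiField φ e) q =
      (inner ℝ (e q) (mlieBracket (𝓡 3) e (phiField φ e) q) : ℝ) • e q
      + (inner ℝ (φ q (e q)) (mlieBracket (𝓡 3) e (phiField φ e) q) : ℝ) • φ q (e q) := by
  have h := hM.expand (he.eta q hq) (he.unit q hq) (mlieBracket (𝓡 3) e (phiField φ e) q)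
  rwa [he.eta_bracket hM hq, zero_smul, add_zero] at h

theorem hTensor_self (he : IsUnitHorizontal η e U) (hM : IsAlmostKenmotsu φ ξ η) (hq : q ∈ U) :
    hTensor φ ξ e q = hDiag φ ξ e q • e q + hOff φ ξ e q • φ q (e q) := by
  have h1 := he.bracket_xi_phi hM hq
  rw [hTensor]
  change (1 / 2 : ℝ) • (mlieBracket (𝓡 3) ξ (phiField φ e) q - _) = _
  rw [h1, he.bracket_xi hM hq, map_add, map_smul, map_smul, he.phi_phi hM.toIsAlmostContactMetric hq]
  module

/-- Together with `hTensor_self` this shows `h` to be symmetric and trace-free on `ker η`. It comes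
from the same two brackets, because `φ(φ e) = -e` as germs. -/
theorem hTensor_phi (he : IsUnitHorizontal η e U) (hM : IsAlmostKenmotsu φ ξ η) (hq : q ∈ U) :
    hTensor φ ξ (phiField φ e) q = hOff φ ξ e q • e q - hDiag φ ξ e q • φ q (e q) := by
  have hC := hM.toIsAlmostContactMetric
  have h1 : mlieBracket (𝓡 3) ξ (fun y ↦ φ y (phiField φ e y)) q
      = -mlieBracket (𝓡 3) ξ e q := by
    have : (fun y ↦ φ y (phiField φ e y)) =ᶠ[𝓝 q] (-1 : ℝ) • e := by
      filter_upwards [he.eventually_mem hq] with y hy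
      rw [phiField, he.phi_phi hC hy]
      exact (neg_one_smul ℝ (e y)).symm
    rw [EventuallyEq.rfl.mlieBracket_vectorField_eq this,
      mlieBracket_const_smul_right (he.smooth q hq).mdiff, neg_one_smul]
  rw [hTensor, h1, he.bracket_xi_phi hM hq, he.bracket_xi hM hq, map_add, map_smul, map_smul,
    he.phi_phi hC hq]
  module

theorem hTensor_xi (hM : IsAlmostContactMetric φ ξ η) (q : M) : hTensor φ ξ ξ q = 0 := by
  have : (fun y ↦ φ y (ξ y)) = 0 := by ext1 y; exact hM.phi_xi y
  simp [hTensor, this]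

end IsUnitHorizontal
end Frame

/-! ### The Levi-Civita connection in the frame -/

section LeviCivita

open Filter Topology

variable {M : Type*} [TopologicalSpace M] [ChartedSpace (EuclideanSpace ℝ (Fin 3)) M]
  [IsManifold (𝓡 3) ∞ M]
  [RiemannianBundle (fun x : M ↦ TangentSpace (𝓡 3) x)]
  [IsContMDiffRiemannianBundle (𝓡 3) ∞ (EuclideanSpace ℝ (Fin 3))
    (fun x : M ↦ TangentSpace (𝓡 3) x)]
  {φ : Π x : M, TangentSpace (𝓡 3) x →L[ℝ] TangentSpace (𝓡 3) x}
  {ξ : Π x : M, TangentSpace (𝓡 3) x}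
  {η : Π x : M, TangentSpace (𝓡 3) x →L[ℝ] ℝ}
  {D : CovariantDerivative (𝓡 3) (EuclideanSpace ℝ (Fin 3)) (fun x : M ↦ TangentSpace (𝓡 3) x)}

theorem IsLeviCivita.torsion_free (hD : IsLeviCivita D) {X Y : Π x : M, TangentSpace (𝓡 3) x}
    {x : M} (hX : SmoothAt X x) (hY : SmoothAt Y x) :
    D Y x (X x) - D X x (Y x) = mlieBracket (𝓡 3) X Y x :=
  (D.torsion_eq_zero_iff.1 hD.torsion_eq_zero) hX.mdiff hY.mdiff

theorem IsLeviCivita.inner_const (hD : IsLeviCivita D) {X Y : Π x : M, TangentSpace (𝓡 3) x}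
    (Z : Π x : M, TangentSpace (𝓡 3) x) {x : M} {c : ℝ} (hX : SmoothAt X x) (hY : SmoothAt Y x)
    (h : ∀ᶠ y in 𝓝 x, inner ℝ (X y) (Y y) = c) :
    inner ℝ (D X x (Z x)) (Y x) + inner ℝ (X x) (D Y x (Z x)) = (0 : ℝ) := by
  have := hD.metric.mvfderiv_inner_eq Z hX.mdiff hY.mdiff
  rw [mvfderiv_eq_zero_of_eventually_const h] at this
  exact this.symm

namespace IsUnitHorizontal

variable {e : Π x : M, TangentSpace (𝓡 3) x} {U : Set M} {q : M}

/-- The Levi-Civita connection in the frame `(e, φ e, ξ)`. -/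
theorem connection (he : IsUnitHorizontal η e U) (hM : IsAlmostKenmotsu φ ξ η)
    (hD : IsLeviCivita D) (hq : q ∈ U) {u v : ℝ}
    (huv : mlieBracket (𝓡 3) e (phiField φ e) q = u • e q + v • φ q (e q)) :
    D ξ q (e q) = (1 + hOff φ ξ e q) • e q - hDiag φ ξ e q • φ q (e q) ∧
    D ξ q (φ q (e q)) = -hDiag φ ξ e q • e q + (1 - hOff φ ξ e q) • φ q (e q) ∧
    D ξ q (ξ q) = 0 ∧
    D e q (ξ q) = frameRot φ ξ e q • φ q (e q) ∧
    D (phiField φ e) q (ξ q) = -frameRot φ ξ e q • e q ∧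
    D e q (e q) = -u • φ q (e q) - (1 + hOff φ ξ e q) • ξ q ∧
    D (phiField φ e) q (e q) = u • e q + hDiag φ ξ e q • ξ q ∧
    D e q (φ q (e q)) = -v • φ q (e q) + hDiag φ ξ e q • ξ q ∧
    D (phiField φ e) q (φ q (e q)) = v • e q - (1 - hOff φ ξ e q) • ξ q := by
  have hC := hM.toIsAlmostContactMetric
  have se := he.smooth q hq
  have sf := he.smooth_phi hC hq
  have sx := hM.smooth_xi q
  set f := phiField φ e with hf
  have ef : φ q (e q) = f q := rfl
  have hee : ∀ᶠ y in 𝓝 q, inner ℝ (e y) (e y) = (1 : ℝ) := (he.eventually_mem hq).mono he.unit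
  have hff : ∀ᶠ y in 𝓝 q, inner ℝ (f y) (f y) = (1 : ℝ) :=
    (he.eventually_mem hq).mono fun y hy ↦ he.unit_phi hC hy
  have hxx : ∀ᶠ y in 𝓝 q, inner ℝ (ξ y) (ξ y) = (1 : ℝ) :=
    Eventually.of_forall fun y ↦ by rw [hC.inner_xi, hC.eta_xi]
  have hef : ∀ᶠ y in 𝓝 q, inner ℝ (e y) (f y) = (0 : ℝ) :=
    Eventually.of_forall fun y ↦ hC.inner_phi_self y _
  have hex : ∀ᶠ y in 𝓝 q, inner ℝ (e y) (ξ y) = (0 : ℝ) :=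
    (he.eventually_mem hq).mono fun y hy ↦ by rw [hC.inner_xi, he.eta y hy]
  have hfx : ∀ᶠ y in 𝓝 q, inner ℝ (f y) (ξ y) = (0 : ℝ) :=
    Eventually.of_forall fun y ↦ by rw [hC.inner_xi]; exact hC.eta_phi y _
  have b1 := (hD.torsion_free sx se).trans (he.bracket_xi hM hq)
  have b2 := (hD.torsion_free sx sf).trans (he.bracket_xi_phi hM hq)
  have b3 := (hD.torsion_free se sf).trans huv
  rw [ef] at *
  have i1 := hee.self_of_nhds
  have i2 := hff.self_of_nhds
  have i3 := hxx.self_of_nhds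
  have i4 := hef.self_of_nhds
  have i5 := hex.self_of_nhds
  have i6 := hfx.self_of_nhds
  have i4' := (real_inner_comm (e q) (f q)).trans i4
  have i5' := (real_inner_comm (e q) (ξ q)).trans i5
  have i6' := (real_inner_comm (f q) (ξ q)).trans i6
  have T : ∀ {a b c : TangentSpace (𝓡 3) q}, a - b = c → ∀ w, (inner ℝ w a - inner ℝ w b : ℝ)
      = inner ℝ w c := fun h w ↦ by rw [← h, inner_sub_right]
  have m (X Y : Π x : M, TangentSpace (𝓡 3) x) (c : ℝ) (hX : SmoothAt X q) (hY : SmoothAt Y q)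
      (h : ∀ᶠ y in 𝓝 q, inner ℝ (X y) (Y y) = c) (Z : Π x : M, TangentSpace (𝓡 3) x) :
      inner ℝ (Y q) (D X q (Z q)) + inner ℝ (X q) (D Y q (Z q)) = (0 : ℝ) := by
    rw [← hD.inner_const Z hX hY h, real_inner_comm]
  have mee := m e e _ se se hee
  have mff := m f f _ sf sf hff
  have mxx := m ξ ξ _ sx sx hxx
  have mef := m e f _ se sf hef
  have mex := m e ξ _ se sx hex
  have mfx := m f ξ _ sf sx hfx
  have t1e := T b1 (e q)
  have t1f := T b1 (f q)
  have t1x := T b1 (ξ q)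
  have t2e := T b2 (e q)
  have t2f := T b2 (f q)
  have t2x := T b2 (ξ q)
  have t3e := T b3 (e q)
  have t3f := T b3 (f q)
  have t3x := T b3 (ξ q)
  simp only [inner_add_right, inner_smul_right, i1, i2, i4, i4', i5', i6'] at t1e t1f t1x t2e t2f t2x t3e t3f t3x
  have ext (a b : TangentSpace (𝓡 3) q) (h1 : inner ℝ (e q) a = (inner ℝ (e q) b : ℝ))
      (h2 : inner ℝ (f q) a = (inner ℝ (f q) b : ℝ)) (h3 : inner ℝ (ξ q) a = (inner ℝ (ξ q) b : ℝ)) :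
      a = b := by
    refine hC.frame_ext (he.eta q hq) (he.unit q hq) h1 h2 ?_
    rw [← hC.inner_xi, ← hC.inner_xi, real_inner_comm, h3, real_inner_comm]
  have mee1 := mee e
  have mee2 := mee f
  have mee3 := mee ξ
  have mff1 := mff e
  have mff2 := mff f
  have mff3 := mff ξ
  have mxx1 := mxx e
  have mxx2 := mxx f
  have mxx3 := mxx ξ
  have mef1 := mef e
  have mef2 := mef f
  have mef3 := mef ξ
  have mex1 := mex e
  have mex2 := mex f
  have mex3 := mex ξ
  have mfx1 := mfx e
  have mfx2 := mfx f
  have mfx3 := mfx ξ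
  clear mee mff mxx mef mex mfx m T b1 b2 b3 huv hee hff hxx hef hex hfx
  -- The nine covariant derivatives have 27 components. Metric compatibility on the six pairs of
  -- frame fields gives 18 linear equations and the three torsion identities give 9; each component
  -- is a linear consequence.
  refine ⟨?_, ?_, ?_, ?_, ?_, ?_, ?_, ?_, ?_⟩ <;> apply ext <;>
    simp only [inner_add_right, inner_sub_right, inner_smul_right, inner_zero_right,
      i1, i2, i3, i4, i5, i6, i4', i5', i6'] <;> linarith

end IsUnitHorizontal
end LeviCivita

/-! ### The nullity condition for `R(·, ξ)ξ` -/

section Curvature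

open Filter Topology

variable {M : Type*} [TopologicalSpace M] [ChartedSpace (EuclideanSpace ℝ (Fin 3)) M]
  [IsManifold (𝓡 3) ∞ M]
  [RiemannianBundle (fun x : M ↦ TangentSpace (𝓡 3) x)]
  [IsContMDiffRiemannianBundle (𝓡 3) ∞ (EuclideanSpace ℝ (Fin 3))
    (fun x : M ↦ TangentSpace (𝓡 3) x)]
  {φ : Π x : M, TangentSpace (𝓡 3) x →L[ℝ] TangentSpace (𝓡 3) x}
  {ξ : Π x : M, TangentSpace (𝓡 3) x}
  {η : Π x : M, TangentSpace (𝓡 3) x →L[ℝ] ℝ}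
  {k μ : M → ℝ}
  {D : CovariantDerivative (𝓡 3) (EuclideanSpace ℝ (Fin 3)) (fun x : M ↦ TangentSpace (𝓡 3) x)}

omit [IsManifold (𝓡 3) ∞ M] [RiemannianBundle (fun x : M ↦ TangentSpace (𝓡 3) x)]
  [IsContMDiffRiemannianBundle (𝓡 3) ∞ (EuclideanSpace ℝ (Fin 3))
    (fun x : M ↦ TangentSpace (𝓡 3) x)] in
theorem mvfderiv_const_add {f : M → ℝ} {x : M} (hf : MDifferentiableAt (𝓡 3) 𝓘(ℝ, ℝ) f x)
    (c : ℝ) : mvfderiv (𝓡 3) (fun y ↦ c + f y) x = mvfderiv (𝓡 3) f x := by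
  rw [mvfderiv_fun_add mdifferentiableAt_const hf,
    mvfderiv_eq_zero_of_eventually_const (c := c) (Eventually.of_forall fun _ ↦ rfl), zero_add]

omit [IsManifold (𝓡 3) ∞ M] [RiemannianBundle (fun x : M ↦ TangentSpace (𝓡 3) x)]
  [IsContMDiffRiemannianBundle (𝓡 3) ∞ (EuclideanSpace ℝ (Fin 3))
    (fun x : M ↦ TangentSpace (𝓡 3) x)] in
theorem mvfderiv_const_sub {f : M → ℝ} {x : M} (hf : MDifferentiableAt (𝓡 3) 𝓘(ℝ, ℝ) f x)
    (c : ℝ) : mvfderiv (𝓡 3) (fun y ↦ c - f y) x = -mvfderiv (𝓡 3) f x := by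
  rw [mvfderiv_fun_sub mdifferentiableAt_const hf,
    mvfderiv_eq_zero_of_eventually_const (c := c) (Eventually.of_forall fun _ ↦ rfl), zero_sub]

namespace IsUnitHorizontal

variable {e : Π x : M, TangentSpace (𝓡 3) x} {U : Set M} {q : M}

theorem contMDiffAt_hDiag (he : IsUnitHorizontal η e U) (hM : IsAlmostContactMetric φ ξ η)
    (hq : q ∈ U) : ContMDiffAt (𝓡 3) 𝓘(ℝ, ℝ) ∞ (hDiag φ ξ e) q := by
  have sf := he.smooth_phi hM hq
  have se := he.smooth q hq
  have sx := hM.smooth_xi q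
  exact contMDiffAt_const.mul ((sf.inner (sx.mlieBracket se)).add (se.inner (sx.mlieBracket sf)))

theorem contMDiffAt_hOff (he : IsUnitHorizontal η e U) (hM : IsAlmostContactMetric φ ξ η)
    (hq : q ∈ U) : ContMDiffAt (𝓡 3) 𝓘(ℝ, ℝ) ∞ (hOff φ ξ e) q := by
  have sf := he.smooth_phi hM hq
  have se := he.smooth q hq
  have sx := hM.smooth_xi q
  exact contMDiffAt_const.mul ((sf.inner (sx.mlieBracket sf)).sub (se.inner (sx.mlieBracket se)))

omit [IsContMDiffRiemannianBundle (𝓡 3) ∞ (EuclideanSpace ℝ (Fin 3))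
    (fun x : M ↦ TangentSpace (𝓡 3) x)] in
/-- Linear combinations of the frame are determined by their coefficients. -/
theorem coeff_eq (he : IsUnitHorizontal η e U) (hM : IsAlmostContactMetric φ ξ η) (hq : q ∈ U)
    {a b c d : ℝ} (h : a • e q + b • φ q (e q) = c • e q + d • φ q (e q)) : a = c ∧ b = d := by
  have h0 := hM.inner_phi_self q (e q)
  have h0' := (real_inner_comm (e q) (φ q (e q))).trans h0
  constructor
  · have := congrArg (fun w ↦ (inner ℝ (e q) w : ℝ)) h
    simpa only [inner_add_right, inner_smul_right, he.unit q hq, h0, mul_one, mul_zero,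
      add_zero] using this
  · have := congrArg (fun w ↦ (inner ℝ (φ q (e q)) w : ℝ)) h
    simpa only [inner_add_right, inner_smul_right, he.unit_phi hM hq, h0', mul_one, mul_zero,
      zero_add] using this

/-- These are the components of `R(e, ξ)ξ` and `R(φ e, ξ)ξ`: a Riccati-type system for `h` along the
flow of `ξ`. -/
theorem nullity_xi (he : IsUnitHorizontal η e U) (hM : IsAlmostKenmotsu φ ξ η)
    (hD : IsLeviCivita D) (hq : q ∈ U)
    (hR : ∀ X Y : Π x : M, TangentSpace (𝓡 3) x, SmoothAt X q → SmoothAt Y q →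
      curvature D X Y ξ q = k q • (η q (Y q) • X q - η q (X q) • Y q)
        + μ q • (η q (Y q) • hTensor φ ξ X q - η q (X q) • hTensor φ ξ Y q)) :
    (-mvfderiv (𝓡 3) (hOff φ ξ e) q (ξ q) - 2 * hDiag φ ξ e q * frameRot φ ξ e q
      - (1 + hOff φ ξ e q) ^ 2 - hDiag φ ξ e q ^ 2 = k q + μ q * hDiag φ ξ e q) ∧
    (mvfderiv (𝓡 3) (hDiag φ ξ e) q (ξ q) + 2 * hDiag φ ξ e q
      - 2 * hOff φ ξ e q * frameRot φ ξ e q = μ q * hOff φ ξ e q) ∧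
    (2 * hDiag φ ξ e q * frameRot φ ξ e q + mvfderiv (𝓡 3) (hOff φ ξ e) q (ξ q)
      - hDiag φ ξ e q ^ 2 - (1 - hOff φ ξ e q) ^ 2 = k q - μ q * hDiag φ ξ e q) := by
  have hC := hM.toIsAlmostContactMetric
  have se := he.smooth q hq
  have sf := he.smooth_phi hC hq
  have sx := hM.smooth_xi q
  have sA := he.contMDiffAt_hDiag hC hq
  have sB := he.contMDiffAt_hOff hC hq
  have hU := he.eventually_mem hq
  obtain ⟨c1, c2, c3, c4, c5, -⟩ := he.connection hM hD hq (he.bracket_phi hM hq)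
  -- The second covariant derivatives differentiate `∇ξ` as a field, so the connection table is
  -- needed on a neighbourhood of `q`.
  have C (y : M) (hy : y ∈ U) := he.connection hM hD hy (he.bracket_phi hM hy)
  have cst (c : ℝ) : ContMDiffAt (𝓡 3) 𝓘(ℝ, ℝ) ∞ (fun _ : M ↦ c) q := contMDiffAt_const
  have D0 (v) : D (fun y ↦ D ξ y (ξ y)) q v = 0 := by
    have := covariantDerivative_combination D se se (cst 0) (cst 0)
      (σ := fun y ↦ D ξ y (ξ y)) (hU.mono fun y hy ↦ by simp [(C y hy).2.2.1]) v
    rw [this, mvfderiv_eq_zero_of_eventually_const (c := 0) (by simp)]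
    simp
  have D1 (v) := covariantDerivative_combination D (σ := fun y ↦ D ξ y (e y))
    (f := fun y ↦ 1 + hOff φ ξ e y) (g := fun y ↦ -hDiag φ ξ e y) se sf
    ((cst 1).add sB) sA.neg (hU.mono fun y hy ↦ by
      rw [(C y hy).1, sub_eq_add_neg, ← neg_smul]) v
  have D2 (v) := covariantDerivative_combination D (σ := fun y ↦ D ξ y (phiField φ e y))
    (f := fun y ↦ -hDiag φ ξ e y) (g := fun y ↦ 1 - hOff φ ξ e y) se sf
    sA.neg ((cst 1).sub sB) (hU.mono fun y hy ↦ (C y hy).2.1) v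
  have dadd : mvfderiv (𝓡 3) (fun y ↦ 1 + hOff φ ξ e y) q = mvfderiv (𝓡 3) (hOff φ ξ e) q :=
    mvfderiv_const_add (sB.mdifferentiableAt (by simp)) 1
  have dsub : mvfderiv (𝓡 3) (fun y ↦ 1 - hOff φ ξ e y) q = -mvfderiv (𝓡 3) (hOff φ ξ e) q :=
    mvfderiv_const_sub (sB.mdifferentiableAt (by simp)) 1
  have dneg : mvfderiv (𝓡 3) (fun y ↦ -hDiag φ ξ e y) q = -mvfderiv (𝓡 3) (hDiag φ ξ e) q :=
    mvfderiv_neg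
  have r1 := hR e ξ se sx
  have r2 := hR (phiField φ e) ξ sf sx
  rw [curvature, D0, D1, mlieBracket_swap_apply, he.bracket_xi hM hq, hC.eta_xi, he.eta q hq,
    he.hTensor_self hM hq, map_neg, map_add, map_smul, map_smul, c1, c2, c4, c5, dadd, dneg] at r1
  rw [curvature, D0, D2, mlieBracket_swap_apply, he.bracket_xi_phi hM hq, hC.eta_xi, hC.eta_phi,
    he.hTensor_phi hM hq, map_neg, map_add, map_smul, map_smul, c1, c2, c4, c5, dsub, dneg] at r2
  simp only [phiField, neg_apply] at r1 r2
  generalize mvfderiv (𝓡 3) (hOff φ ξ e) q (ξ q) = dB at *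
  generalize mvfderiv (𝓡 3) (hDiag φ ξ e) q (ξ q) = dA at *
  have s1 := he.coeff_eq hC hq (a := -dB - 2 * hDiag φ ξ e q * frameRot φ ξ e q
      - (1 + hOff φ ξ e q) ^ 2 - hDiag φ ξ e q ^ 2)
    (b := dA + 2 * hDiag φ ξ e q - 2 * hOff φ ξ e q * frameRot φ ξ e q)
    (c := k q + μ q * hDiag φ ξ e q) (d := μ q * hOff φ ξ e q)
    (by linear_combination (norm := module) r1)
  have s2 := he.coeff_eq hC hq (a := dA + 2 * hDiag φ ξ e q - 2 * hOff φ ξ e q * frameRot φ ξ e q)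
    (b := 2 * hDiag φ ξ e q * frameRot φ ξ e q + dB - hDiag φ ξ e q ^ 2 - (1 - hOff φ ξ e q) ^ 2)
    (c := μ q * hOff φ ξ e q) (d := k q - μ q * hDiag φ ξ e q)
    (by linear_combination (norm := module) r2)
  -- The omitted `s2.1` is the same equation as `s1.2`.
  exact ⟨s1.1, s1.2, s2.2⟩

/-- Adding the two diagonal equations cancels both the derivative along `ξ` and `μ`. -/
theorem hDiag_sq_add_hOff_sq (he : IsUnitHorizontal η e U) (hM : IsAlmostKenmotsu φ ξ η)
    (hD : IsLeviCivita D) (hq : q ∈ U)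
    (hR : ∀ X Y : Π x : M, TangentSpace (𝓡 3) x, SmoothAt X q → SmoothAt Y q →
      curvature D X Y ξ q = k q • (η q (Y q) • X q - η q (X q) • Y q)
        + μ q • (η q (Y q) • hTensor φ ξ X q - η q (X q) • hTensor φ ξ Y q)) :
    hDiag φ ξ e q ^ 2 + hOff φ ξ e q ^ 2 = -1 - k q := by
  obtain ⟨h1, -, h3⟩ := he.nullity_xi hM hD hq hR
  linarith


end IsUnitHorizontal
end Curvature

/-! ### A smooth eigenframe of `h` -/

section Eigenframe

open Filter Topology

variable {M : Type*} [TopologicalSpace M] [ChartedSpace (EuclideanSpace ℝ (Fin 3)) M]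
  [IsManifold (𝓡 3) ∞ M]
  [RiemannianBundle (fun x : M ↦ TangentSpace (𝓡 3) x)]
  [IsContMDiffRiemannianBundle (𝓡 3) ∞ (EuclideanSpace ℝ (Fin 3))
    (fun x : M ↦ TangentSpace (𝓡 3) x)]
  {φ : Π x : M, TangentSpace (𝓡 3) x →L[ℝ] TangentSpace (𝓡 3) x}
  {ξ : Π x : M, TangentSpace (𝓡 3) x}
  {η : Π x : M, TangentSpace (𝓡 3) x →L[ℝ] ℝ}
  {k μ : M → ℝ}
  {D : CovariantDerivative (𝓡 3) (EuclideanSpace ℝ (Fin 3)) (fun x : M ↦ TangentSpace (𝓡 3) x)}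

omit [RiemannianBundle (fun x : M ↦ TangentSpace (𝓡 3) x)]
  [IsContMDiffRiemannianBundle (𝓡 3) ∞ (EuclideanSpace ℝ (Fin 3))
    (fun x : M ↦ TangentSpace (𝓡 3) x)] in
theorem exists_smooth_extension (p : M) (v : TangentSpace (𝓡 3) p) :
    ∃ (W : Π x : M, TangentSpace (𝓡 3) x) (U : Set M), IsOpen U ∧ p ∈ U ∧
      (∀ q ∈ U, SmoothAt W q) ∧ W p = v := by
  obtain ⟨s, hs, hsm⟩ := FiberBundle.exists_contMDiffOn_extend (k := ∞) (𝓡 3)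
    (EuclideanSpace ℝ (Fin 3)) v
  refine ⟨FiberBundle.extend (EuclideanSpace ℝ (Fin 3)) v, interior s, isOpen_interior,
    mem_interior_iff_mem_nhds.2 hs, fun q hq ↦ ?_, by simp⟩
  exact hsm.contMDiffAt (mem_interior_iff_mem_nhds.1 hq)

/-- The scaling factor `c` is returned along with the frame, so that its smoothness can be used when
`h` is applied to the normalized field. -/
theorem IsUnitHorizontal.exists_normalize
    {W : Π x : M, TangentSpace (𝓡 3) x} {U : Set M} (hU : IsOpen U)
    (hW : ∀ q ∈ U, SmoothAt W q) (hη : ∀ q ∈ U, η q (W q) = 0) {p : M} (hp : p ∈ U)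
    (hWp : W p ≠ 0) :
    ∃ (c : M → ℝ) (V : Set M), V ⊆ U ∧ p ∈ V ∧ (∀ q ∈ V, ContMDiffAt (𝓡 3) 𝓘(ℝ, ℝ) ∞ c q) ∧
      IsUnitHorizontal η (fun y ↦ c y • W y) V := by
  have hs (q : M) (hq : q ∈ U) := (hW q hq).inner (hW q hq)
  have hpos (q : M) (hq : inner ℝ (W q) (W q) ≠ (0 : ℝ)) : (0 : ℝ) < inner ℝ (W q) (W q) :=
    lt_of_le_of_ne real_inner_self_nonneg hq.symm
  have hsm (q : M) (hq : q ∈ U) (h0 : inner ℝ (W q) (W q) ≠ (0 : ℝ)) :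
      ContMDiffAt (𝓡 3) 𝓘(ℝ, ℝ) ∞ (fun y ↦ (√(inner ℝ (W y) (W y)))⁻¹) q := by
    have : ContDiffAt ℝ ∞ (fun t : ℝ ↦ (√t)⁻¹) (inner ℝ (W q) (W q)) :=
      (Real.contDiffAt_sqrt h0).inv (Real.sqrt_ne_zero'.2 (hpos q h0))
    exact ContMDiffAt.comp q (g := fun t : ℝ ↦ (√t)⁻¹) this.contMDiffAt (hs q hq)
  refine ⟨fun y ↦ (√(inner ℝ (W y) (W y)))⁻¹, U ∩ {q | inner ℝ (W q) (W q) ≠ (0 : ℝ)},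
    Set.inter_subset_left, ⟨hp, inner_self_ne_zero.2 hWp⟩, fun q hq ↦ hsm q hq.1 hq.2, ?_, ?_, ?_, ?_⟩
  · exact ContinuousOn.isOpen_inter_preimage
      (fun q hq ↦ (hs q hq).continuousAt.continuousWithinAt) hU isOpen_ne
  · exact fun q hq ↦ (hW q hq.1).smul (hsm q hq.1 hq.2)
  · intro q hq
    rw [map_smul, hη q hq.1, smul_zero]
  · intro q hq
    rw [inner_smul_left, inner_smul_right, ← mul_assoc, RCLike.conj_to_real, ← mul_inv,
      Real.mul_self_sqrt real_inner_self_nonneg, inv_mul_cancel₀ hq.2]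

theorem IsUnitHorizontal.exists (hM : IsAlmostContactMetric φ ξ η) (p : M) :
    ∃ (e : Π x : M, TangentSpace (𝓡 3) x) (U : Set M), p ∈ U ∧ IsUnitHorizontal η e U := by
  have hv : ∃ v : TangentSpace (𝓡 3) p, v - η p v • ξ p ≠ 0 := by
    by_contra! h
    have h1 : Module.finrank ℝ (TangentSpace (𝓡 3) p) ≤ 1 :=
      finrank_le_one (ξ p) fun w ↦ ⟨η p w, (sub_eq_zero.1 (h w)).symm⟩
    have h2 : Module.finrank ℝ (TangentSpace (𝓡 3) p) = 3 := by
      change Module.finrank ℝ (EuclideanSpace ℝ (Fin 3)) = 3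
      simp
    omega
  obtain ⟨v, hv⟩ := hv
  obtain ⟨W, U, hU, hp, hW, hWp⟩ := exists_smooth_extension p v
  have hη (q : M) (hq : q ∈ U) : ContMDiffAt (𝓡 3) 𝓘(ℝ, ℝ) ∞ (fun y ↦ -η y (W y)) q := by
    have := (hW q hq).inner (hM.smooth_xi q)
    simp only [hM.inner_xi] at this
    exact this.neg
  obtain ⟨c, V, -, hpV, -, hV⟩ := exists_normalize (η := η) hU (W := fun y ↦ W y + (-η y (W y)) • ξ y)
    (fun q hq ↦ (hW q hq).add ((hM.smooth_xi q).smul (hη q hq)))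
    (fun q hq ↦ by simp [hM.eta_xi]) hp (by rwa [hWp, neg_smul, ← sub_eq_add_neg])
  exact ⟨_, V, hpV, hV⟩

omit [RiemannianBundle (fun x : M ↦ TangentSpace (𝓡 3) x)]
  [IsContMDiffRiemannianBundle (𝓡 3) ∞ (EuclideanSpace ℝ (Fin 3))
    (fun x : M ↦ TangentSpace (𝓡 3) x)] in
theorem mlieBracket_combination {Z σ X Y : Π x : M, TangentSpace (𝓡 3) x} {f g : M → ℝ} {q : M}
    (hX : SmoothAt X q) (hY : SmoothAt Y q) (hf : ContMDiffAt (𝓡 3) 𝓘(ℝ, ℝ) ∞ f q)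
    (hg : ContMDiffAt (𝓡 3) 𝓘(ℝ, ℝ) ∞ g q) (h : ∀ᶠ y in 𝓝 q, σ y = f y • X y + g y • Y y) :
    mlieBracket (𝓡 3) Z σ q = mvfderiv (𝓡 3) f q (Z q) • X q + f q • mlieBracket (𝓡 3) Z X q
      + (mvfderiv (𝓡 3) g q (Z q) • Y q + g q • mlieBracket (𝓡 3) Z Y q) := by
  have h' : σ =ᶠ[𝓝 q] (f • X + g • Y) := h
  rw [EventuallyEq.rfl.mlieBracket_vectorField_eq h',
    mlieBracket_add_right (V := Z) (W := f • X) (W₁ := g • Y) (hX.smul hf).mdiff (hY.smul hg).mdiff,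
    mlieBracket_smul_right (hf.mdifferentiableAt (by simp)) hX.mdiff,
    mlieBracket_smul_right (hg.mdifferentiableAt (by simp)) hY.mdiff]

omit [IsContMDiffRiemannianBundle (𝓡 3) ∞ (EuclideanSpace ℝ (Fin 3))
    (fun x : M ↦ TangentSpace (𝓡 3) x)] in
-- `h` is defined through brackets of fields, so its tensoriality has to be checked: the terms with
-- derivatives of `f` and `g` cancel between `[ξ, φσ]` and `φ[ξ, σ]`.
theorem hTensor_combination (hM : IsAlmostContactMetric φ ξ η)
    {σ X Y : Π x : M, TangentSpace (𝓡 3) x} {f g : M → ℝ} {q : M}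
    (hX : SmoothAt X q) (hY : SmoothAt Y q) (hf : ContMDiffAt (𝓡 3) 𝓘(ℝ, ℝ) ∞ f q)
    (hg : ContMDiffAt (𝓡 3) 𝓘(ℝ, ℝ) ∞ g q) (h : ∀ᶠ y in 𝓝 q, σ y = f y • X y + g y • Y y) :
    hTensor φ ξ σ q = f q • hTensor φ ξ X q + g q • hTensor φ ξ Y q := by
  have h' : ∀ᶠ y in 𝓝 q, φ y (σ y) = f y • φ y (X y) + g y • φ y (Y y) :=
    h.mono fun y hy ↦ by rw [hy, map_add, map_smul, map_smul]
  simp only [hTensor]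
  rw [mlieBracket_combination hX hY hf hg h,
    mlieBracket_combination (hX.clm_apply hM.smooth_phi) (hY.clm_apply hM.smooth_phi) hf hg h']
  simp only [map_add, map_smul]
  module

/-- On `ker η` one has `(h - λ)(h + λ) = 0`, so `h + λ` maps any horizontal field to a
`λ`-eigenfield. Applied to `e` or to `φ e`, it gives a field that is nonzero at `p`, which can be
normalized. -/
theorem IsUnitHorizontal.exists_eigenframe (hM : IsAlmostKenmotsu φ ξ η) (hD : IsLeviCivita D)
    (hk : ContMDiff (𝓡 3) 𝓘(ℝ, ℝ) ∞ k) (hk1 : ∀ x, k x < -1)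
    (hR : ∀ (x : M) (X Y : Π x : M, TangentSpace (𝓡 3) x), SmoothAt X x → SmoothAt Y x →
      curvature D X Y ξ x = k x • (η x (Y x) • X x - η x (X x) • Y x)
        + μ x • (η x (Y x) • hTensor φ ξ X x - η x (X x) • hTensor φ ξ Y x)) (p : M) :
    ∃ (e : Π x : M, TangentSpace (𝓡 3) x) (U : Set M), p ∈ U ∧ IsUnitHorizontal η e U ∧
      ∀ q ∈ U, hDiag φ ξ e q = √(-1 - k q) ∧ hOff φ ξ e q = 0 := by
  have hC := hM.toIsAlmostContactMetric
  obtain ⟨e, U, hp, he⟩ := IsUnitHorizontal.exists hC p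
  have hpos (q : M) : 0 < -1 - k q := by linarith [hk1 q]
  have hsq (q : M) : √(-1 - k q) ^ 2 = -1 - k q := Real.sq_sqrt (hpos q).le
  have hsum (q : M) (hq : q ∈ U) := he.hDiag_sq_add_hOff_sq hM hD hq (hR q)
  have hl (q : M) : ContMDiffAt (𝓡 3) 𝓘(ℝ, ℝ) ∞ (fun y ↦ √(-1 - k y)) q :=
    (Real.contDiffAt_sqrt (hpos q).ne').contMDiffAt.comp q (contMDiffAt_const.sub (hk q))
  have key (a b : M → ℝ) (ha : ∀ q ∈ U, ContMDiffAt (𝓡 3) 𝓘(ℝ, ℝ) ∞ a q)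
      (hb : ∀ q ∈ U, ContMDiffAt (𝓡 3) 𝓘(ℝ, ℝ) ∞ b q)
      (h1 : ∀ q ∈ U, a q * hDiag φ ξ e q + b q * hOff φ ξ e q = √(-1 - k q) * a q)
      (h2 : ∀ q ∈ U, a q * hOff φ ξ e q - b q * hDiag φ ξ e q = √(-1 - k q) * b q)
      (h0 : a p • e p + b p • φ p (e p) ≠ 0) :
      ∃ (e : Π x : M, TangentSpace (𝓡 3) x) (U : Set M), p ∈ U ∧ IsUnitHorizontal η e U ∧
        ∀ q ∈ U, hDiag φ ξ e q = √(-1 - k q) ∧ hOff φ ξ e q = 0 := by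
    obtain ⟨c, V, hVU, hpV, hc, hV⟩ := exists_normalize (η := η) he.isOpen
      (W := fun y ↦ a y • e y + b y • phiField φ e y)
      (fun q hq ↦ ((he.smooth q hq).smul (ha q hq)).add ((he.smooth_phi hC hq).smul (hb q hq)))
      (fun q hq ↦ by simp [phiField, he.eta q hq, hC.eta_phi]) hp h0
    refine ⟨_, V, hpV, hV, fun q hq ↦ ?_⟩
    have hqU := hVU hq
    have hh := hTensor_combination hC (σ := fun y ↦ c y • (a y • e y + b y • phiField φ e y))
      (f := fun y ↦ c y * a y) (g := fun y ↦ c y * b y)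
      (he.smooth q hqU) (he.smooth_phi hC hqU) ((hc q hq).mul (ha q hqU))
      ((hc q hq).mul (hb q hqU)) (Eventually.of_forall fun y ↦ by module)
    rw [hV.hTensor_self hM hq, he.hTensor_self hM hqU, he.hTensor_phi hM hqU] at hh
    have hh' := hV.coeff_eq hC hq (c := √(-1 - k q)) (d := 0) (hh.trans ?_)
    · exact hh'
    · simp only [phiField, zero_smul, add_zero, smul_add, smul_smul]
      have e1 := h1 q hqU
      have e2 := h2 q hqU
      have E1 : c q * a q * hDiag φ ξ e q + c q * b q * hOff φ ξ e q = √(-1 - k q) * (c q * a q) := by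
        linear_combination c q * e1
      have E2 : c q * a q * hOff φ ξ e q - c q * b q * hDiag φ ξ e q = √(-1 - k q) * (c q * b q) := by
        linear_combination c q * e2
      rw [← E1, ← E2]
      module
  have hAs (q : M) (hq : q ∈ U) := he.contMDiffAt_hDiag hC hq
  have hBs (q : M) (hq : q ∈ U) := he.contMDiffAt_hOff hC hq
  -- `(h + λ)e` has components `(λ + hDiag, hOff)` and `(h + λ)φe` has `(hOff, λ - hDiag)`. If
  -- `hDiag = -λ` at `p`, the last entry is `2λ > 0`; otherwise `λ + hDiag ≠ 0`.
  by_cases h : hDiag φ ξ e p = -√(-1 - k p)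
  · refine key (hOff φ ξ e) (fun q ↦ √(-1 - k q) - hDiag φ ξ e q) hBs
      (fun q hq ↦ (hl q).sub (hAs q hq)) (fun q hq ↦ by ring)
      (fun q hq ↦ by linear_combination hsum q hq - hsq q) fun h0 ↦ ?_
    have := (he.coeff_eq hC hp (c := 0) (d := 0) (by simpa using h0)).2
    have := Real.sqrt_pos.2 (hpos p)
    linarith
  · refine key (fun q ↦ √(-1 - k q) + hDiag φ ξ e q) (hOff φ ξ e)
      (fun q hq ↦ (hl q).add (hAs q hq)) hBs
      (fun q hq ↦ by linear_combination hsum q hq - hsq q) (fun q hq ↦ by ring) fun h0 ↦ h ?_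
    have := (he.coeff_eq hC hp (c := 0) (d := 0) (by simpa using h0)).1
    linarith

end Eigenframe

/-! ### Structure equations of the eigenframe -/

section StructureEquations

open Filter Topology

variable {M : Type*} [TopologicalSpace M] [ChartedSpace (EuclideanSpace ℝ (Fin 3)) M]
  [IsManifold (𝓡 3) ∞ M]
  [RiemannianBundle (fun x : M ↦ TangentSpace (𝓡 3) x)]
  [IsContMDiffRiemannianBundle (𝓡 3) ∞ (EuclideanSpace ℝ (Fin 3))
    (fun x : M ↦ TangentSpace (𝓡 3) x)]
  {φ : Π x : M, TangentSpace (𝓡 3) x →L[ℝ] TangentSpace (𝓡 3) x}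
  {ξ : Π x : M, TangentSpace (𝓡 3) x}
  {η : Π x : M, TangentSpace (𝓡 3) x →L[ℝ] ℝ}
  {k μ : M → ℝ}
  {D : CovariantDerivative (𝓡 3) (EuclideanSpace ℝ (Fin 3)) (fun x : M ↦ TangentSpace (𝓡 3) x)}

omit [RiemannianBundle (fun x : M ↦ TangentSpace (𝓡 3) x)] [IsManifold (𝓡 3) ∞ M]
  [IsContMDiffRiemannianBundle (𝓡 3) ∞ (EuclideanSpace ℝ (Fin 3))
    (fun x : M ↦ TangentSpace (𝓡 3) x)] in
theorem mvfderiv_of_sq_eq {f k : M → ℝ} {q : M} (hf : MDifferentiableAt (𝓡 3) 𝓘(ℝ, ℝ) f q)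
    (hk : MDifferentiableAt (𝓡 3) 𝓘(ℝ, ℝ) k q) (h : ∀ᶠ y in 𝓝 q, f y * f y = -1 - k y)
    (v : TangentSpace (𝓡 3) q) : 2 * f q * mvfderiv (𝓡 3) f q v = -mvfderiv (𝓡 3) k q v := by
  have h3 : mvfderiv (𝓡 3) (fun y ↦ f y * f y + k y) q = 0 :=
    mvfderiv_eq_zero_of_eventually_const (c := -1) (h.mono fun y hy ↦ by rw [hy]; ring)
  have hff : MDifferentiableAt (𝓡 3) 𝓘(ℝ, ℝ) (fun y ↦ f y * f y) q := hf.mul hf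
  rw [mvfderiv_fun_add hff hk, mvfderiv_fun_mul hf hf] at h3
  have := congrArg (fun L ↦ L v) h3
  simp only [add_apply, smul_apply, smul_eq_mul, zero_apply] at this
  linarith

theorem IsUnitHorizontal.structure_equations {e : Π x : M, TangentSpace (𝓡 3) x} {U : Set M}
    (he : IsUnitHorizontal η e U) (hM : IsAlmostKenmotsu φ ξ η) (hD : IsLeviCivita D)
    (hk : ContMDiff (𝓡 3) 𝓘(ℝ, ℝ) ∞ k) (hk1 : ∀ x, k x < -1)
    (hR : ∀ (x : M) (X Y : Π x : M, TangentSpace (𝓡 3) x), SmoothAt X x → SmoothAt Y x →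
      curvature D X Y ξ x = k x • (η x (Y x) • X x - η x (X x) • Y x)
        + μ x • (η x (Y x) • hTensor φ ξ X x - η x (X x) • hTensor φ ξ Y x))
    (hdk : ∀ (x : M) (v w : TangentSpace (𝓡 3) x),
      wedgeOneOne (mvfderiv (𝓡 3) k x) (η x) v w = 0)
    (hlam : ∀ q ∈ U, hDiag φ ξ e q = √(-1 - k q) ∧ hOff φ ξ e q = 0) {q : M} (hq : q ∈ U) :
    mlieBracket (𝓡 3) ξ e q = -e q + (√(-1 - k q) - μ q / 2) • φ q (e q) ∧
    mlieBracket (𝓡 3) ξ (phiField φ e) q = (√(-1 - k q) + μ q / 2) • e q - φ q (e q) ∧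
    mlieBracket (𝓡 3) e (phiField φ e) q = 0 ∧
    mvfderiv (𝓡 3) k q (e q) = 0 ∧ mvfderiv (𝓡 3) k q (φ q (e q)) = 0 ∧
    mvfderiv (𝓡 3) k q (ξ q) = -(4 * (k q + 1)) := by
  have hC := hM.toIsAlmostContactMetric
  have hpos : 0 < √(-1 - k q) := Real.sqrt_pos.2 (by linarith [hk1 q])
  have hsq : √(-1 - k q) ^ 2 = -1 - k q := Real.sq_sqrt (by linarith [hk1 q])
  have hU := he.eventually_mem hq
  obtain ⟨hA, hB⟩ := hlam q hq
  obtain ⟨n1, n2, n3⟩ := he.nullity_xi hM hD hq (hR q)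
  have dB : mvfderiv (𝓡 3) (hOff φ ξ e) q = 0 :=
    mvfderiv_eq_zero_of_eventually_const (hU.mono fun y hy ↦ (hlam y hy).2)
  have sA := he.contMDiffAt_hDiag hC hq
  have dA := mvfderiv_of_sq_eq (sA.mdifferentiableAt (by simp)) ((hk q).mdifferentiableAt (by simp))
    (hU.mono fun y hy ↦ by
      rw [(hlam y hy).1, Real.mul_self_sqrt (by linarith [hk1 y])])
  have k0 (v : TangentSpace (𝓡 3) q) (hv : η q v = 0) : mvfderiv (𝓡 3) k q v = 0 := by
    have := hdk q v (ξ q)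
    simpa [wedgeOneOne, hC.eta_xi, hv] using this
  have ke := k0 _ (he.eta q hq)
  have kf := k0 _ (hC.eta_phi q (e q))
  have A0 (v : TangentSpace (𝓡 3) q) (hv : η q v = 0) : mvfderiv (𝓡 3) (hDiag φ ξ e) q v = 0 := by
    have := dA v
    rw [k0 v hv, hA] at this
    have h2 : 2 * √(-1 - k q) ≠ 0 := by positivity
    simpa [h2, hpos.ne'] using this
  have Ae := A0 _ (he.eta q hq)
  have Af := A0 _ (hC.eta_phi q (e q))
  have dAx := dA (ξ q)
  rw [dB, hA, hB] at n1
  rw [hA, hB] at n2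
  rw [hA] at dAx
  -- With `hDiag = λ` and `hOff = 0`, the first nullity equation reduces to `-2λω = μλ`.
  have hω : frameRot φ ξ e q = -μ q / 2 := by
    have : √(-1 - k q) * (2 * frameRot φ ξ e q + μ q) = 0 := by
      simp only [zero_apply] at n1
      linear_combination -n1 - hsq
    rcases mul_eq_zero.1 this with h | h
    · exact absurd h hpos.ne'
    · linarith
  have b1 := he.bracket_xi hM hq
  have b2 := he.bracket_xi_phi hM hq
  rw [hA, hB, hω] at b1 b2
  have se := he.smooth q hq
  have sf := he.smooth_phi hC hq
  have b3 := he.bracket_phi hM hq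
  set u : ℝ := inner ℝ (e q) (mlieBracket (𝓡 3) e (phiField φ e) q)
  set v : ℝ := inner ℝ (φ q (e q)) (mlieBracket (𝓡 3) e (phiField φ e) q)
  obtain ⟨c1, c2, -, -, -, c6, c7, c8, c9⟩ := he.connection hM hD hq b3
  have C (y : M) (hy : y ∈ U) := he.connection hM hD hy (he.bracket_phi hM hy)
  have cst (c : ℝ) : ContMDiffAt (𝓡 3) 𝓘(ℝ, ℝ) ∞ (fun _ : M ↦ c) q := contMDiffAt_const
  have D1 (v) := covariantDerivative_combination D (σ := fun y ↦ D ξ y (e y))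
    (f := fun _ ↦ 1) (g := fun y ↦ -hDiag φ ξ e y) se sf (cst 1) sA.neg
    (hU.mono fun y hy ↦ by
      rw [(C y hy).1, sub_eq_add_neg, ← neg_smul, (hlam y hy).2, add_zero]) v
  have D2 (v) := covariantDerivative_combination D (σ := fun y ↦ D ξ y (phiField φ e y))
    (f := fun y ↦ -hDiag φ ξ e y) (g := fun _ ↦ 1) se sf sA.neg (cst 1)
    (hU.mono fun y hy ↦ by
      simp only [phiField]
      rw [(C y hy).2.1, (hlam y hy).2, sub_zero]) v
  have d1 : mvfderiv (𝓡 3) (fun _ : M ↦ (1 : ℝ)) q = 0 :=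
    mvfderiv_eq_zero_of_eventually_const (Eventually.of_forall fun _ ↦ rfl)
  have dneg : mvfderiv (𝓡 3) (fun y ↦ -hDiag φ ξ e y) q = -mvfderiv (𝓡 3) (hDiag φ ξ e) q :=
    mvfderiv_neg
  have r := hR q e (phiField φ e) se sf
  rw [curvature, D1, D2, b3, map_add, map_smul, map_smul, hC.eta_phi, he.eta q hq, d1, dneg] at r
  simp only [phiField, neg_apply] at r
  rw [Ae, Af, c1, c2] at r
  change _ • D e q (e q) + _ + (_ • D (phiField φ e) q (e q) + _)
    - (_ • D e q (φ q (e q)) + _ + (_ • D (phiField φ e) q (φ q (e q)) + _)) - _ = _ at r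
  rw [c6, c7, c8, c9, hA, hB] at r
  -- Since `e` and `φ e` are horizontal, `R(e, φe)ξ = 0`. As `λ` has no horizontal derivative, the
  -- curvature is just `2λ(v e + u φe)`.
  have huv := he.coeff_eq hC hq (a := 2 * √(-1 - k q) * v) (b := 2 * √(-1 - k q) * u)
    (c := 0) (d := 0) (by linear_combination (norm := (simp only [zero_apply]; module)) r)
  have h2 : 2 * √(-1 - k q) ≠ 0 := by positivity
  have hv0 : v = 0 := (mul_eq_zero.1 huv.1).resolve_left h2
  have hu0 : u = 0 := (mul_eq_zero.1 huv.2).resolve_left h2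
  refine ⟨?_, ?_, ?_, ke, kf, ?_⟩
  · rw [b1]; module
  · rw [b2]; module
  · rw [b3, hu0, hv0, zero_smul, zero_smul, add_zero]
  -- `n2` reads `ξ(λ) = -2λ` and `dAx` reads `2λ ξ(λ) = -ξ(k)`, whence `ξ(k) = 4λ² = -4(k + 1)`.
  · linear_combination dAx - 2 * √(-1 - k q) * n2 + 4 * hsq

omit [IsContMDiffRiemannianBundle (𝓡 3) ∞ (EuclideanSpace ℝ (Fin 3))
    (fun x : M ↦ TangentSpace (𝓡 3) x)] in
theorem IsUnitHorizontal.mvfderiv_mu_eq_zero {e : Π x : M, TangentSpace (𝓡 3) x} {U : Set M}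
    (he : IsUnitHorizontal η e U) (hM : IsAlmostContactMetric φ ξ η)
    (hk : ContMDiff (𝓡 3) 𝓘(ℝ, ℝ) ∞ k) (hμ : ContMDiff (𝓡 3) 𝓘(ℝ, ℝ) ∞ μ)
    (hk1 : ∀ x, k x < -1)
    (h : ∀ q ∈ U,
      mlieBracket (𝓡 3) ξ e q = -e q + (√(-1 - k q) - μ q / 2) • φ q (e q) ∧
      mlieBracket (𝓡 3) ξ (phiField φ e) q = (√(-1 - k q) + μ q / 2) • e q - φ q (e q) ∧
      mlieBracket (𝓡 3) e (phiField φ e) q = 0 ∧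
      mvfderiv (𝓡 3) k q (e q) = 0 ∧ mvfderiv (𝓡 3) k q (φ q (e q)) = 0 ∧
      mvfderiv (𝓡 3) k q (ξ q) = -(4 * (k q + 1))) {q : M} (hq : q ∈ U) :
    mvfderiv (𝓡 3) μ q (e q) = 0 ∧ mvfderiv (𝓡 3) μ q (φ q (e q)) = 0 := by
  have se := he.smooth q hq
  have sf := he.smooth_phi hM hq
  have sx := hM.smooth_xi q
  have hU := he.eventually_mem hq
  obtain ⟨-, -, b3, ke, kf, -⟩ := h q hq
  have hpos : 0 < -1 - k q := by linarith [hk1 q]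
  have hl : ContMDiffAt (𝓡 3) 𝓘(ℝ, ℝ) ∞ (fun y ↦ √(-1 - k y)) q :=
    (Real.contDiffAt_sqrt hpos.ne').contMDiffAt.comp q (contMDiffAt_const.sub (hk q))
  have hm : ContMDiffAt (𝓡 3) 𝓘(ℝ, ℝ) ∞ (fun y ↦ μ y * (1 / 2)) q :=
    (hμ q).mul contMDiffAt_const
  have dl := mvfderiv_of_sq_eq (hl.mdifferentiableAt (by simp)) ((hk q).mdifferentiableAt (by simp))
    (hU.mono fun y hy ↦ Real.mul_self_sqrt (by linarith [hk1 y]))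
  have hs : 2 * √(-1 - k q) ≠ 0 := by positivity
  have le : mvfderiv (𝓡 3) (fun y ↦ √(-1 - k y)) q (e q) = 0 := by
    have := dl (e q)
    rw [ke, neg_zero] at this
    exact (mul_eq_zero.1 this).resolve_left hs
  have lf : mvfderiv (𝓡 3) (fun y ↦ √(-1 - k y)) q (φ q (e q)) = 0 := by
    have := dl (φ q (e q))
    rw [kf, neg_zero] at this
    exact (mul_eq_zero.1 this).resolve_left hs
  have cst (c : ℝ) : ContMDiffAt (𝓡 3) 𝓘(ℝ, ℝ) ∞ (fun _ : M ↦ c) q := contMDiffAt_const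
  have dc (c : ℝ) : mvfderiv (𝓡 3) (fun _ : M ↦ c) q = 0 :=
    mvfderiv_eq_zero_of_eventually_const (Eventually.of_forall fun _ ↦ rfl)
  have dm : mvfderiv (𝓡 3) (fun y ↦ μ y * (1 / 2)) q = (1 / 2 : ℝ) • mvfderiv (𝓡 3) μ q := by
    rw [mvfderiv_fun_mul ((hμ q).mdifferentiableAt (by simp)) mdifferentiableAt_const, dc, smul_zero,
      zero_add]
  have E1 := mlieBracket_combination (Z := phiField φ e) (σ := mlieBracket (𝓡 3) ξ e)
    (f := fun _ ↦ -1) (g := fun y ↦ √(-1 - k y) - μ y * (1 / 2)) se sf (cst _) (hl.sub hm)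
    (hU.mono fun y hy ↦ by rw [(h y hy).1]; module)
  have E2 := mlieBracket_combination (Z := e) (σ := mlieBracket (𝓡 3) ξ (phiField φ e))
    (f := fun y ↦ √(-1 - k y) + μ y * (1 / 2)) (g := fun _ ↦ -1) se sf (hl.add hm) (cst _)
    (hU.mono fun y hy ↦ by rw [(h y hy).2.1]; module)
  have E3 : mlieBracket (𝓡 3) ξ (mlieBracket (𝓡 3) e (phiField φ e)) q = 0 := by
    have : mlieBracket (𝓡 3) e (phiField φ e) =ᶠ[𝓝 q] 0 := hU.mono fun y hy ↦ (h y hy).2.2.1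
    rw [EventuallyEq.rfl.mlieBracket_vectorField_eq this]
    exact congrFun mlieBracket_zero_right q
  have two : minSmoothness ℝ 2 ≤ ∞ := by
    rw [minSmoothness_of_isRCLikeNormedField]
    exact WithTop.coe_le_coe.2 (le_top : (2 : ℕ∞) ≤ ⊤)
  have : IsManifold (𝓡 3) (minSmoothness ℝ 3) M :=
    IsManifold.of_le (n := ∞) (by
      rw [minSmoothness_of_isRCLikeNormedField]
      exact WithTop.coe_le_coe.2 (le_top : (3 : ℕ∞) ≤ ⊤))
  -- Since `[e, φe] = 0`, the Jacobi identity becomes `[e, [ξ, φe]] = [φe, [ξ, e]]`. Only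
  -- derivatives of the coefficients survive, leaving `½ e(μ) e + ½ (φe)(μ) φe = 0`.
  have J := leibniz_identity_mlieBracket_apply (ContMDiffAt.of_le sx two) (ContMDiffAt.of_le se two)
    (ContMDiffAt.of_le sf two)
  rw [E3, mlieBracket_swap_apply (W := phiField φ e), E1, E2, mlieBracket_self, mlieBracket_self,
    mlieBracket_swap_apply (V := phiField φ e), b3, dc, mvfderiv_fun_sub
      (hl.mdifferentiableAt (by simp)) (hm.mdifferentiableAt (by simp)), mvfderiv_fun_add
      (hl.mdifferentiableAt (by simp)) (hm.mdifferentiableAt (by simp)), dm] at J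
  simp only [sub_apply, add_apply, smul_apply, le, lf, zero_apply, smul_eq_mul, Pi.zero_apply] at J
  have c := he.coeff_eq hM hq (a := 1 / 2 * mvfderiv (𝓡 3) μ q (e q))
    (b := 1 / 2 * mvfderiv (𝓡 3) μ q (φ q (e q))) (c := 0) (d := 0)
    (by linear_combination (norm := module) -J)
  constructor
  · linarith [c.1]
  · linarith [c.2]

end StructureEquations

/-! ### Analytic tools: smooth ODEs, primitives, local inverses, factorization -/

section

open Filter Set
open scoped Topology

section ODE
variable {F : Type*} [NormedAddCommGroup F] [NormedSpace ℝ F] 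

/-- Solutions of an ODE with smooth right-hand side are smooth. -/
theorem contDiffOn_of_hasDerivAt {f : ℝ × F → F} {u : ℝ → F} {s : Set ℝ} (hs : IsOpen s)
    {W : Set (ℝ × F)} (hf : ContDiffOn ℝ ∞ f W) (hW : ∀ t ∈ s, (t, u t) ∈ W)
    (hu : ∀ t ∈ s, HasDerivAt u (f (t, u t)) t) : ContDiffOn ℝ ∞ u s := by
  rw [contDiffOn_infty]
  intro n
  induction n with
  | zero =>
    rw [Nat.cast_zero, contDiffOn_zero]
    exact fun t ht ↦ (hu t ht).continuousAt.continuousWithinAt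
  | succ n ih =>
    rw [Nat.cast_add, Nat.cast_one, contDiffOn_succ_iff_deriv_of_isOpen hs]
    refine ⟨fun t ht ↦ (hu t ht).differentiableAt.differentiableWithinAt, by simp, ?_⟩
    have : ContDiffOn ℝ n (fun t ↦ f (t, u t)) s :=
      (hf.of_le (by exact_mod_cast le_top)).comp (contDiffOn_id.prodMk ih) hW
    exact this.congr fun t ht ↦ (hu t ht).deriv

/-- Local existence of smooth solutions of a time-dependent ODE with smooth right-hand side. -/
theorem exists_contDiffOn_hasDerivAt [CompleteSpace F] {f : ℝ × F → F} {t₀ : ℝ} {u₀ : F}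
    {W : Set (ℝ × F)} (hWo : IsOpen W) (hf : ContDiffOn ℝ ∞ f W) (hW : (t₀, u₀) ∈ W) :
    ∃ (u : ℝ → F) (ε : ℝ), 0 < ε ∧ u t₀ = u₀ ∧ ContDiffOn ℝ ∞ u (Ioo (t₀ - ε) (t₀ + ε)) ∧
      ∀ t ∈ Ioo (t₀ - ε) (t₀ + ε), HasDerivAt u (f (t, u t)) t := by
  -- Time is added as a coordinate: the autonomous field `(1, f)` is integrated, and `hfst` checks
  -- that its first component is `t`.
  have hf1 : ContDiffAt ℝ 1 (fun z : ℝ × F ↦ ((1 : ℝ), f z)) (t₀, u₀) :=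
    contDiffAt_const.prodMk ((hf.contDiffAt (hWo.mem_nhds hW)).of_le (by simp))
  obtain ⟨α, hα0, ε, hε, hα⟩ := hf1.exists_forall_mem_closedBall_exists_eq_forall_mem_Ioo_hasDerivAt₀ t₀
  have hfst : ∀ t ∈ Ioo (t₀ - ε) (t₀ + ε), (α t).1 = t := by
    intro t ht
    have h0 : t₀ ∈ Ioo (t₀ - ε) (t₀ + ε) := by constructor <;> linarith
    have hd (x : ℝ) (hx : x ∈ Ioo (t₀ - ε) (t₀ + ε)) : HasDerivAt (fun t ↦ (α t).1 - t) (1 - 1) x := by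
      have h1 : HasDerivAt (fun t ↦ (α t).1) 1 x :=
        (ContinuousLinearMap.fst ℝ ℝ F).hasFDerivAt.comp_hasDerivAt x (hα x hx)
      exact h1.sub (hasDerivAt_id x)
    have := (convex_Ioo (t₀ - ε) (t₀ + ε)).is_const_of_fderivWithin_eq_zero (𝕜 := ℝ)
      (f := fun t ↦ (α t).1 - t)
      (fun x hx ↦ (hd x hx).differentiableAt.differentiableWithinAt)
      (fun x hx ↦ by
        have h1 := hd x hx
        rw [sub_self] at h1
        have h2 := h1.hasFDerivAt.hasFDerivWithinAt (s := Ioo (t₀ - ε) (t₀ + ε))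
        rw [h2.fderivWithin (isOpen_Ioo.uniqueDiffWithinAt hx)]
        simp) ht h0
    simp only [hα0, sub_self] at this
    linarith
  have hcont : ContinuousAt α t₀ := (hα t₀ (by constructor <;> linarith)).continuousAt
  have hev : ∀ᶠ t in 𝓝 t₀, α t ∈ W := hcont.eventually_mem (by rw [hα0]; exact hWo.mem_nhds hW)
  obtain ⟨δ, hδ, hδW⟩ := Metric.eventually_nhds_iff_ball.1 hev
  rw [Real.ball_eq_Ioo] at hδW
  have hsub : Ioo (t₀ - min ε δ) (t₀ + min ε δ) ⊆ Ioo (t₀ - ε) (t₀ + ε) :=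
    Ioo_subset_Ioo (by linarith [min_le_left ε δ]) (by linarith [min_le_left ε δ])
  have hsub' : Ioo (t₀ - min ε δ) (t₀ + min ε δ) ⊆ Ioo (t₀ - δ) (t₀ + δ) :=
    Ioo_subset_Ioo (by linarith [min_le_right ε δ]) (by linarith [min_le_right ε δ])
  have heq (t : ℝ) (ht : t ∈ Ioo (t₀ - min ε δ) (t₀ + min ε δ)) : (t, (α t).2) = α t :=
    Prod.ext (hfst t (hsub ht)).symm rfl
  have hder : ∀ t ∈ Ioo (t₀ - min ε δ) (t₀ + min ε δ),
      HasDerivAt (fun t ↦ (α t).2) (f (t, (α t).2)) t := fun t ht ↦ by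
    rw [heq t ht]; exact hasFDerivAt_snd.comp_hasDerivAt t (hα t (hsub ht))
  refine ⟨fun t ↦ (α t).2, min ε δ, lt_min hε hδ, by simp [hα0], ?_, hder⟩
  exact contDiffOn_of_hasDerivAt isOpen_Ioo hf (fun t ht ↦ by rw [heq t ht]; exact hδW t (hsub' ht))
    hder
end ODE

section Poincare
variable {E : Type*} [NormedAddCommGroup E] [NormedSpace ℝ E]

/-- A smooth closed `1`-form on an open convex set has a smooth primitive. -/
theorem exists_contDiffOn_primitive {θ : E → E →L[ℝ] ℝ} {s : Set E} (hs : Convex ℝ s)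
    (hso : IsOpen s) (hθ : ContDiffOn ℝ ∞ θ s)
    (hdθ : ∀ a ∈ s, ∀ x y, fderiv ℝ θ a x y = fderiv ℝ θ a y x) :
    ∃ w : E → ℝ, ContDiffOn ℝ ∞ w s ∧ ∀ a ∈ s, HasFDerivAt w (θ a) a := by
  obtain ⟨w, hw⟩ := hs.exists_forall_hasFDerivAt_of_fderiv_symmetric hso
    (hθ.differentiableOn (by simp)) hdθ
  refine ⟨w, ?_, hw⟩
  rw [show (∞ : ℕ∞ω) = ∞ + 1 by rfl, contDiffOn_succ_iff_fderiv_of_isOpen hso]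
  exact ⟨fun a ha ↦ (hw a ha).differentiableAt.differentiableWithinAt, by simp,
    hθ.congr fun a ha ↦ (hw a ha).fderiv⟩

/-- Closedness of a `1`-form may be tested on a spanning family of vector fields. -/
theorem fderiv_symm_of_span {θ : E → E →L[ℝ] ℝ} {V : Fin 3 → E → E} {a : E}
    (hθ : DifferentiableAt ℝ θ a) (hV : ∀ i, DifferentiableAt ℝ (V i) a)
    (hspan : ∀ v : E, ∃ c : Fin 3 → ℝ, v = ∑ i, c i • V i a)
    (h : ∀ i j, i < j → fderiv ℝ (fun y ↦ θ y (V j y)) a (V i a)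
      - fderiv ℝ (fun y ↦ θ y (V i y)) a (V j a)
      = θ a (VectorField.lieBracket ℝ (V i) (V j) a)) (x y : E) :
    fderiv ℝ θ a x y = fderiv ℝ θ a y x := by
  have key (i j : Fin 3) (hij : i < j) :
      fderiv ℝ θ a (V i a) (V j a) = fderiv ℝ θ a (V j a) (V i a) := by
    have := h i j hij
    -- By the product rule the terms containing `dV` are `θ` of the bracket; what remains is the
    -- antisymmetrized `dθ`.
    rw [fderiv_clm_apply hθ (hV i), fderiv_clm_apply hθ (hV j), VectorField.lieBracket] at this
    simp only [add_apply, ContinuousLinearMap.comp_apply,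
      ContinuousLinearMap.flip_apply, map_sub] at this
    linarith
  have key' (i j : Fin 3) : fderiv ℝ θ a (V i a) (V j a) = fderiv ℝ θ a (V j a) (V i a) := by
    rcases lt_trichotomy i j with hij | rfl | hij
    · exact key i j hij
    · rfl
    · exact (key j i hij).symm
  obtain ⟨c, rfl⟩ := hspan x
  obtain ⟨d, rfl⟩ := hspan y
  simp only [map_sum, map_smul, sum_apply, smul_apply, smul_eq_mul, Finset.mul_sum]
  rw [Finset.sum_comm]
  refine Finset.sum_congr rfl fun i _ ↦ Finset.sum_congr rfl fun j _ ↦ ?_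
  rw [key']
  ring
end Poincare

section LocalDiffeomorphism

variable {E E' : Type*} [NormedAddCommGroup E] [NormedSpace ℝ E] [CompleteSpace E]
  [NormedAddCommGroup E'] [NormedSpace ℝ E']

/-- The inverse function theorem for smooth maps: a local inverse that is smooth on its domain. -/
theorem exists_openPartialHomeomorph_contDiffOn_symm {Φ : E → E'} {U : Set E} (hU : IsOpen U)
    {p : E} (hp : p ∈ U) (hΦ : ContDiffOn ℝ ∞ Φ U) {L : E ≃L[ℝ] E'}
    (hL : HasFDerivAt Φ (L : E →L[ℝ] E') p) :
    ∃ e : OpenPartialHomeomorph E E', p ∈ e.source ∧ e.source ⊆ U ∧ (∀ x, e x = Φ x) ∧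
      ContDiffOn ℝ ∞ e.symm e.target := by
  have hc : ContinuousOn (fderiv ℝ Φ) U := hΦ.continuousOn_fderiv_of_isOpen hU (by simp)
  -- Restricting to points with invertible derivative makes the inverse smooth on the whole target,
  -- not only at the image of `p`.
  let V := U ∩ fderiv ℝ Φ ⁻¹' range ((↑) : (E ≃L[ℝ] E') → E →L[ℝ] E')
  have hV : IsOpen V := hc.isOpen_inter_preimage hU ContinuousLinearEquiv.isOpen
  have hpV : p ∈ V := ⟨hp, L, hL.fderiv.symm⟩
  let e₀ := (hΦ.contDiffAt (hU.mem_nhds hp)).toOpenPartialHomeomorph Φ hL (by simp)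
  refine ⟨e₀.restrOpen V hV, ⟨?_, hpV⟩, fun x hx ↦ hx.2.1, fun x ↦ rfl, fun y hy ↦ ?_⟩
  · exact ContDiffAt.mem_toOpenPartialHomeomorph_source _ hL (by simp)
  · have hx := (e₀.restrOpen V hV).map_target hy
    obtain ⟨hxU, T, hT⟩ := hx.2
    have hd := hΦ.contDiffAt (hU.mem_nhds hxU)
    refine ContDiffAt.contDiffWithinAt ?_
    refine OpenPartialHomeomorph.contDiffAt_symm _ hy (f₀' := T) ?_ hd
    rw [hT]
    exact (hd.differentiableAt (by simp)).hasFDerivAt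

end LocalDiffeomorphism

section Factor
variable {E : Type*} [NormedAddCommGroup E] [NormedSpace ℝ E] [CompleteSpace E]

/-- If `dμ` vanishes on the kernel of `dK ≠ 0`, then locally `μ` is a smooth function of `K`. -/
theorem exists_factor {K μ : E → ℝ} {U : Set E} (hU : IsOpen U) {p v : E} (hp : p ∈ U)
    (hK : ContDiffOn ℝ ∞ K U) (hμ : ContDiffOn ℝ ∞ μ U) (hv : fderiv ℝ K p v = 1)
    (h : ∀ x ∈ U, ∀ w, fderiv ℝ K x w = 0 → fderiv ℝ μ x w = 0) :
    ∃ (m : ℝ → ℝ) (ε : ℝ), 0 < ε ∧ ContDiffOn ℝ ∞ m (Ioo (K p - ε) (K p + ε)) ∧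
      ∀ᶠ x in 𝓝 p, K x ∈ Ioo (K p - ε) (K p + ε) ∧ μ x = m (K x) := by
  set ℓ := fderiv ℝ K p with hℓ
  -- As `ℓ v = 1`, this map satisfies `ℓ ∘ Φ = K`, and its derivative at `p` is the identity: it
  -- straightens the level sets of `K` to those of `ℓ`.
  let Φ : E → E := fun x ↦ x + (K x - ℓ x) • v
  have hKp := ((hK.contDiffAt (hU.mem_nhds hp)).differentiableAt (by simp)).hasFDerivAt
  have hΦ : ContDiffOn ℝ ∞ Φ U :=
    contDiffOn_id.add ((hK.sub ℓ.contDiff.contDiffOn).smul contDiffOn_const)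
  have hL : HasFDerivAt Φ (ContinuousLinearEquiv.refl ℝ E : E →L[ℝ] E) p := by
    have := (hasFDerivAt_id p).add ((hKp.sub ℓ.hasFDerivAt).smul_const v)
    rw [← hℓ, sub_self] at this
    simpa using! this
  obtain ⟨e, hpe, heU, he, hes⟩ := exists_openPartialHomeomorph_contDiffOn_symm hU hp hΦ hL
  have hℓΦ (x : E) : ℓ (Φ x) = K x := by simp [Φ, hv]
  have hKe (y : E) (hy : y ∈ e.target) : K (e.symm y) = ℓ y := by
    rw [← hℓΦ, ← he, e.right_inv hy]
  obtain ⟨r, hr, hball⟩ := Metric.isOpen_iff.1 e.open_target (Φ p) (he p ▸ e.map_source hpe)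
  have hg : ContDiffOn ℝ ∞ (μ ∘ e.symm) e.target :=
    hμ.comp hes fun y hy ↦ heU (e.map_target hy)
  have hg0 (y : E) (hy : y ∈ e.target) (w : E) (hw : ℓ w = 0) :
      fderiv ℝ (μ ∘ e.symm) y w = 0 := by
    have hxU := heU (e.map_target hy)
    have h1 := (hes.contDiffAt (e.open_target.mem_nhds hy)).differentiableAt (by simp)
    have h2 := (hμ.contDiffAt (hU.mem_nhds hxU)).differentiableAt (by simp)
    have h3 := (hK.contDiffAt (hU.mem_nhds hxU)).differentiableAt (by simp)
    rw [fderiv_comp y h2 h1]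
    refine h _ hxU _ ?_
    have h4 : K ∘ e.symm =ᶠ[𝓝 y] ℓ := by
      filter_upwards [e.open_target.mem_nhds hy] with z hz using hKe z hz
    have h5 := fderiv_comp y h3 h1
    rw [h4.fderiv_eq, ℓ.fderiv] at h5
    rw [← hw, h5]
    rfl
  let ε := r / (‖v‖ + 1)
  have hε : 0 < ε := by positivity
  have hmem (t : ℝ) (ht : t ∈ Ioo (K p - ε) (K p + ε)) : Φ p + (t - K p) • v ∈ Metric.ball (Φ p) r := by
    rw [Metric.mem_ball, dist_self_add_left, norm_smul]
    have h1 : ‖t - K p‖ < ε := by rw [Real.norm_eq_abs, abs_lt]; constructor <;> linarith [ht.1, ht.2]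
    calc ‖t - K p‖ * ‖v‖ ≤ ε * ‖v‖ := by gcongr
      _ < ε * (‖v‖ + 1) := by gcongr; linarith
      _ = r := by simp only [ε]; field_simp
  -- `m` is `μ` read along the transversal line on which `ℓ` takes the value `t`.
  refine ⟨fun t ↦ (μ ∘ e.symm) (Φ p + (t - K p) • v), ε, hε, ?_, ?_⟩
  · refine hg.comp (t := e.target) (f := fun t : ℝ ↦ Φ p + (t - K p) • v) ?_
      fun t ht ↦ hball (hmem t ht)
    fun_prop
  · have hKc : ContinuousAt K p := hKp.continuousAt
    filter_upwards [hKc.eventually_mem (Ioo_mem_nhds (by linarith : K p - ε < K p)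
      (by linarith : K p < K p + ε)), hL.continuousAt.eventually_mem (Metric.ball_mem_nhds (Φ p) hr),
      e.open_source.mem_nhds hpe] with x hxK hxΦ hxe
    refine ⟨hxK, ?_⟩
    have hy' := hmem _ hxK
    set y' := Φ p + (K x - K p) • v
    have hw : ℓ (Φ x - y') = 0 := by simp [y', hℓΦ, hv]
    -- `Φ x` and `y'` lie on the same level of `ℓ`, and the segment joining them stays in the ball;
    -- `μ ∘ e.symm` is constant along it.
    have hseg (t : ℝ) (ht : t ∈ Icc (0 : ℝ) 1) : y' + t • (Φ x - y') ∈ e.target := by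
      refine hball ((convex_ball (Φ p) r).add_smul_sub_mem hy' hxΦ ht)
    have hder (t : ℝ) (ht : t ∈ Icc (0 : ℝ) 1) :
        HasDerivAt (fun t : ℝ ↦ (μ ∘ e.symm) (y' + t • (Φ x - y'))) 0 t := by
      have h1 := ((hg.contDiffAt (e.open_target.mem_nhds (hseg t ht))).differentiableAt
        (by simp)).hasFDerivAt
      have h2 : HasDerivAt (fun t : ℝ ↦ y' + t • (Φ x - y')) (Φ x - y') t := by
        simpa using ((hasDerivAt_id t).smul_const (Φ x - y')).const_add y'
      have h3 := h1.comp_hasDerivAt t h2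
      rwa [hg0 _ (hseg t ht) _ hw] at h3
    have := constant_of_has_deriv_right_zero
      (fun t ht ↦ (hder t ht).continuousAt.continuousWithinAt)
      (fun t ht ↦ (hder t (Ico_subset_Icc_self ht)).hasDerivWithinAt) 1 (right_mem_Icc.2 zero_le_one)
    simp only [one_smul, add_sub_cancel, zero_smul, add_zero, Function.comp_apply] at this
    rw [← he x, e.left_inv hxe] at this
    exact this
end Factor

end

/-! ### Planar linear systems and dual coframes -/

section

open Filter Set
open scoped Topology

section FundamentalSolution

/-- A planar linear ODE with smooth coefficients has a local smooth fundamental system. -/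
theorem exists_fundamental_solution {a b c : ℝ → ℝ} {s : Set ℝ} (hs : IsOpen s) {t₀ : ℝ}
    (ht₀ : t₀ ∈ s) (ha : ContDiffOn ℝ ∞ a s) (hb : ContDiffOn ℝ ∞ b s) (hc : ContDiffOn ℝ ∞ c s) :
    ∃ (P Q : Fin 2 → ℝ → ℝ) (J : Set ℝ), IsOpen J ∧ t₀ ∈ J ∧ J ⊆ s ∧
      (∀ i, ContDiffOn ℝ ∞ (P i) J) ∧ (∀ i, ContDiffOn ℝ ∞ (Q i) J) ∧
      (∀ i, ∀ t ∈ J, HasDerivAt (P i) (a t * P i t + b t * Q i t) t) ∧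
      (∀ i, ∀ t ∈ J, HasDerivAt (Q i) (c t * P i t + a t * Q i t) t) ∧
      ∀ t ∈ J, P 0 t * Q 1 t - P 1 t * Q 0 t ≠ 0 := by
  let f : ℝ × (ℝ × ℝ) → ℝ × ℝ := fun z ↦
    (a z.1 * z.2.1 + b z.1 * z.2.2, c z.1 * z.2.1 + a z.1 * z.2.2)
  have hf : ContDiffOn ℝ ∞ f (s ×ˢ univ) := by
    have h1 {g : ℝ → ℝ} (hg : ContDiffOn ℝ ∞ g s) :
        ContDiffOn ℝ ∞ (fun z : ℝ × (ℝ × ℝ) ↦ g z.1) (s ×ˢ univ) :=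
      hg.comp contDiffOn_fst fun z hz ↦ hz.1
    have h2 : ContDiffOn ℝ ∞ (fun z : ℝ × (ℝ × ℝ) ↦ z.2.1) (s ×ˢ univ) := by fun_prop
    have h3 : ContDiffOn ℝ ∞ (fun z : ℝ × (ℝ × ℝ) ↦ z.2.2) (s ×ˢ univ) := by fun_prop
    exact (((h1 ha).mul h2).add ((h1 hb).mul h3)).prodMk (((h1 hc).mul h2).add ((h1 ha).mul h3))
  have key (u₀ : ℝ × ℝ) := exists_contDiffOn_hasDerivAt (hs.prod isOpen_univ) hf
    (t₀ := t₀) (u₀ := u₀) ⟨ht₀, trivial⟩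
  choose u ε hε hu₀ hu hd using key
  let w : Fin 2 → ℝ → ℝ × ℝ := ![u (1, 0), u (0, 1)]
  let J₀ := s ∩ Ioo (t₀ - min (ε (1, 0)) (ε (0, 1))) (t₀ + min (ε (1, 0)) (ε (0, 1)))
  have hJ₀ : IsOpen J₀ := hs.inter isOpen_Ioo
  have hmin := lt_min (hε (1, 0)) (hε (0, 1))
  have hsub0 : J₀ ⊆ Ioo (t₀ - ε (1, 0)) (t₀ + ε (1, 0)) := fun t ht ↦ by
    have := min_le_left (ε (1, 0)) (ε (0, 1))
    exact ⟨by linarith [ht.2.1], by linarith [ht.2.2]⟩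
  have hsub1 : J₀ ⊆ Ioo (t₀ - ε (0, 1)) (t₀ + ε (0, 1)) := fun t ht ↦ by
    have := min_le_right (ε (1, 0)) (ε (0, 1))
    exact ⟨by linarith [ht.2.1], by linarith [ht.2.2]⟩
  have hw (i : Fin 2) : ContDiffOn ℝ ∞ (w i) J₀ := by
    fin_cases i
    · exact (hu _).mono hsub0
    · exact (hu _).mono hsub1
  have hdw (i : Fin 2) (t : ℝ) (ht : t ∈ J₀) : HasDerivAt (w i) (f (t, w i t)) t := by
    fin_cases i
    · exact hd _ t (hsub0 ht)
    · exact hd _ t (hsub1 ht)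
  -- The Wronskian is `1` at `t₀`, so independence is obtained by shrinking the interval to where `W
  -- ≠ 0`.
  let W : ℝ → ℝ := fun t ↦ (w 0 t).1 * (w 1 t).2 - (w 1 t).1 * (w 0 t).2
  have hW : ContinuousOn W J₀ := by
    have h0 := (hw 0).continuousOn
    have h1 := (hw 1).continuousOn
    exact (h0.fst.mul h1.snd).sub (h1.fst.mul h0.snd)
  refine ⟨fun i t ↦ (w i t).1, fun i t ↦ (w i t).2, J₀ ∩ W ⁻¹' {0}ᶜ,
    hW.isOpen_inter_preimage hJ₀ isOpen_compl_singleton,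
    ⟨⟨ht₀, by constructor <;> linarith⟩, ?_⟩, fun t ht ↦ ht.1.1,
    fun i ↦ ((hw i).mono inter_subset_left).fst, fun i ↦ ((hw i).mono inter_subset_left).snd,
    fun i t ht ↦ ?_, fun i t ht ↦ ?_, fun t ht ↦ ht.2⟩
  · simp [W, w, hu₀]
  · exact (ContinuousLinearMap.fst ℝ ℝ ℝ).hasFDerivAt.comp_hasDerivAt t (hdw i t ht.1)
  · exact (ContinuousLinearMap.snd ℝ ℝ ℝ).hasFDerivAt.comp_hasDerivAt t (hdw i t ht.1)

end FundamentalSolution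

section Coframe
variable {E : Type*} [NormedAddCommGroup E] [NormedSpace ℝ E] [CompleteSpace E]
variable {ι : Type*} [Fintype ι] [DecidableEq ι]

/-- A smooth frame on an open set has a smooth dual coframe. -/
theorem exists_dual_coframe {V : ι → E → E} {U : Set E}
    (hV : ∀ i, ContDiffOn ℝ ∞ (V i) U) (hli : ∀ x ∈ U, LinearIndependent ℝ fun i ↦ V i x)
    (hspan : ∀ x ∈ U, ∀ v : E, ∃ c : ι → ℝ, v = ∑ i, c i • V i x) :
    ∃ θ : ι → E → E →L[ℝ] ℝ, (∀ i, ContDiffOn ℝ ∞ (θ i) U) ∧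
      ∀ x ∈ U, ∀ i j, θ i x (V j x) = if i = j then 1 else 0 := by
  -- `A x` sends coefficients to the vector they represent; the coframe is read off its inverse, and
  -- inversion is smooth at invertible operators.
  let A : E → (ι → ℝ) →L[ℝ] E := fun x ↦
    ∑ i, (ContinuousLinearMap.proj (R := ℝ) (φ := fun _ : ι ↦ ℝ) i).smulRight (V i x)
  have hA (x : E) (c : ι → ℝ) : A x c = ∑ i, c i • V i x := by simp [A]
  have hAs : ContDiffOn ℝ ∞ A U :=
    ContDiffOn.sum fun i _ ↦ contDiffOn_const.smulRight (hV i)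
  have hinv (x : E) (hx : x ∈ U) :
      ∃ T : (ι → ℝ) ≃L[ℝ] E, (T : (ι → ℝ) →L[ℝ] E) = A x := by
    refine ⟨ContinuousLinearEquiv.ofBijective (A x) ?_ ?_, ?_⟩
    · rw [LinearMap.ker_eq_bot']
      intro c hc
      have hc' : A x c = 0 := hc
      rw [hA] at hc'
      exact funext (Fintype.linearIndependent_iff.1 (hli x hx) c hc')
    · rw [LinearMap.range_eq_top]
      intro v
      obtain ⟨c, rfl⟩ := hspan x hx v
      exact ⟨c, hA x c⟩
    · ext1; rfl
  refine ⟨fun i x ↦ (ContinuousLinearMap.proj (R := ℝ) (φ := fun _ : ι ↦ ℝ) i).comp (A x).inverse,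
    fun i ↦ contDiffOn_const.clm_comp fun x hx ↦ ?_, fun x hx i j ↦ ?_⟩
  · obtain ⟨T, hT⟩ := hinv x hx
    have h1 : ContDiffAt ℝ ∞ ContinuousLinearMap.inverse (A x) := hT ▸ contDiffAt_map_inverse T
    exact h1.comp_contDiffWithinAt x (hAs x hx)
  · obtain ⟨T, hT⟩ := hinv x hx
    have h1 : V j x = T (Pi.single j 1) := by
      rw [← ContinuousLinearEquiv.coe_coe, hT, hA]
      simp [Pi.single_apply]
    beta_reduce
    rw [← hT, ContinuousLinearMap.inverse_equiv, h1]
    simp [Pi.single_apply]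
end Coframe

end

/-! ### Adapted frames and their closed `1`-forms -/

section

open Filter Set
open scoped Topology

section AdaptedCoordinates
variable {E : Type*} [NormedAddCommGroup E] [NormedSpace ℝ E]

/-- The commutation relations of an adapted frame of a generalized `(k, μ)`-manifold, written in
an open subset of a vector space. -/
structure IsAdaptedFrame (V : Fin 3 → E → E) (K μ : E → ℝ) (U : Set E) : Prop where
  isOpen : IsOpen U
  smooth : ∀ i, ContDiffOn ℝ ∞ (V i) U
  smooth_left : ContDiffOn ℝ ∞ K U
  smooth_right : ContDiffOn ℝ ∞ μ U
  linearIndependent : ∀ x ∈ U, LinearIndependent ℝ fun i ↦ V i x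
  span : ∀ x ∈ U, ∀ v : E, ∃ c : Fin 3 → ℝ, v = ∑ i, c i • V i x
  lt : ∀ x ∈ U, K x < -1
  bracket_zero_one : ∀ x ∈ U, VectorField.lieBracket ℝ (V 0) (V 1) x = 0
  bracket_two_zero : ∀ x ∈ U, VectorField.lieBracket ℝ (V 2) (V 0) x =
    -V 0 x + (√(-1 - K x) - μ x / 2) • V 1 x
  bracket_two_one : ∀ x ∈ U, VectorField.lieBracket ℝ (V 2) (V 1) x =
    (√(-1 - K x) + μ x / 2) • V 0 x - V 1 x
  left_zero : ∀ x ∈ U, fderiv ℝ K x (V 0 x) = 0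
  left_one : ∀ x ∈ U, fderiv ℝ K x (V 1 x) = 0
  left_two : ∀ x ∈ U, fderiv ℝ K x (V 2 x) = -(4 * (K x + 1))
  right_zero : ∀ x ∈ U, fderiv ℝ μ x (V 0 x) = 0
  right_one : ∀ x ∈ U, fderiv ℝ μ x (V 1 x) = 0

theorem IsAdaptedFrame.mono {V : Fin 3 → E → E} {K μ : E → ℝ} {U U' : Set E}
    (h : IsAdaptedFrame V K μ U) (hU' : IsOpen U') (hs : U' ⊆ U) : IsAdaptedFrame V K μ U' where
  isOpen := hU'
  smooth i := (h.smooth i).mono hs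
  smooth_left := h.smooth_left.mono hs
  smooth_right := h.smooth_right.mono hs
  linearIndependent x hx := h.linearIndependent x (hs hx)
  span x hx := h.span x (hs hx)
  lt x hx := h.lt x (hs hx)
  bracket_zero_one x hx := h.bracket_zero_one x (hs hx)
  bracket_two_zero x hx := h.bracket_two_zero x (hs hx)
  bracket_two_one x hx := h.bracket_two_one x (hs hx)
  left_zero x hx := h.left_zero x (hs hx)
  left_one x hx := h.left_one x (hs hx)
  left_two x hx := h.left_two x (hs hx)
  right_zero x hx := h.right_zero x (hs hx)
  right_one x hx := h.right_one x (hs hx)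

/-- In an adapted frame, `μ` is locally a smooth function of `K`. -/
theorem IsAdaptedFrame.exists_factor [CompleteSpace E] {V : Fin 3 → E → E} {K μ : E → ℝ} {U : Set E}
    (h : IsAdaptedFrame V K μ U) {p : E} (hp : p ∈ U) :
    ∃ (m : ℝ → ℝ) (ε : ℝ), 0 < ε ∧ ContDiffOn ℝ ∞ m (Ioo (K p - ε) (K p + ε)) ∧
      ∀ᶠ x in 𝓝 p, K x ∈ Ioo (K p - ε) (K p + ε) ∧ μ x = m (K x) := by
  have hne (x : E) (hx : x ∈ U) : -(4 * (K x + 1)) ≠ 0 := by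
    have := h.lt x hx
    intro h0
    linarith
  refine AlmostKenmotsu.exists_factor h.isOpen (v := (-(4 * (K p + 1)))⁻¹ • V 2 p) hp h.smooth_left
    h.smooth_right ?_ fun x hx w hw ↦ ?_
  · rw [map_smul, h.left_two p hp, smul_eq_mul, inv_mul_cancel₀ (hne p hp)]
  · obtain ⟨c, rfl⟩ := h.span x hx w
    simp only [Fin.sum_univ_three, map_add, map_smul, smul_eq_mul, h.left_zero x hx,
      h.left_one x hx, h.left_two x hx, h.right_zero x hx, h.right_one x hx, mul_zero,
      zero_add] at hw ⊢
    rw [(mul_eq_zero.1 hw).resolve_right (hne x hx), zero_mul]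

/-- The closed `1`-forms built from a solution of the linear ODE dual to the frame. -/
theorem IsAdaptedFrame.exists_primitive [CompleteSpace E] {V : Fin 3 → E → E} {K μ : E → ℝ} {U : Set E}
    (h : IsAdaptedFrame V K μ U) (hU : Convex ℝ U) {m P Q : ℝ → ℝ} {J : Set ℝ}
    (hKJ : ∀ x ∈ U, K x ∈ J) (hm : ∀ x ∈ U, μ x = m (K x))
    (hPs : ContDiffOn ℝ ∞ P J) (hQs : ContDiffOn ℝ ∞ Q J)
    (hP : ∀ t ∈ J, HasDerivAt P ((4 * (t + 1))⁻¹ * P t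
      + -(√(-1 - t) - m t / 2) * (4 * (t + 1))⁻¹ * Q t) t)
    (hQ : ∀ t ∈ J, HasDerivAt Q (-(√(-1 - t) + m t / 2) * (4 * (t + 1))⁻¹ * P t
      + (4 * (t + 1))⁻¹ * Q t) t) :
    ∃ w : E → ℝ, ContDiffOn ℝ ∞ w U ∧ ∀ x ∈ U, fderiv ℝ w x (V 0 x) = P (K x) ∧
      fderiv ℝ w x (V 1 x) = Q (K x) ∧ fderiv ℝ w x (V 2 x) = 0 := by
  obtain ⟨θ, hθ, hθV⟩ := exists_dual_coframe h.smooth h.linearIndependent h.span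
  -- On `(V 0, V 1)` closedness holds because `P(K)` and `Q(K)` are constant along both fields,
  -- which commute. On `(V 0, V 2)` and `(V 1, V 2)` it amounts to the equations for `P'` and `Q'`.
  let α : E → E →L[ℝ] ℝ := fun x ↦ P (K x) • θ 0 x + Q (K x) • θ 1 x
  have hα : ContDiffOn ℝ ∞ α U :=
    ((hPs.comp h.smooth_left hKJ).smul (hθ 0)).add ((hQs.comp h.smooth_left hKJ).smul (hθ 1))
  have hα0 (x : E) (hx : x ∈ U) : α x (V 0 x) = P (K x) := by simp [α, hθV x hx]
  have hα1 (x : E) (hx : x ∈ U) : α x (V 1 x) = Q (K x) := by simp [α, hθV x hx]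
  have hα2 (x : E) (hx : x ∈ U) : α x (V 2 x) = 0 := by simp [α, hθV x hx]
  have hev {f g : E → ℝ} (hfg : ∀ x ∈ U, f x = g x) {x : E} (hx : x ∈ U) :
      fderiv ℝ f x = fderiv ℝ g x :=
    Filter.EventuallyEq.fderiv_eq
      (by filter_upwards [h.isOpen.mem_nhds hx] with y hy using hfg y hy)
  have hcomp {R R' : ℝ → ℝ} (hR : ∀ t ∈ J, HasDerivAt R (R' t) t) {x : E} (hx : x ∈ U) (v : E) :
      fderiv ℝ (fun y ↦ R (K y)) x v = R' (K x) * fderiv ℝ K x v := by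
    have h1 := ((h.smooth_left.contDiffAt (h.isOpen.mem_nhds hx)).differentiableAt
      (by simp)).hasFDerivAt
    have h2 := (hR _ (hKJ x hx)).comp_hasFDerivAt x h1
    have h3 : fderiv ℝ (fun y ↦ R (K y)) x = R' (K x) • fderiv ℝ K x := h2.fderiv
    rw [h3, smul_apply, smul_eq_mul]
  obtain ⟨w, hws, hw⟩ := exists_contDiffOn_primitive hU h.isOpen hα fun a ha x y ↦ by
    have hd (i : Fin 3) := ((h.smooth i).contDiffAt (h.isOpen.mem_nhds ha)).differentiableAt
      (by simp)
    have hne : K a + 1 ≠ 0 := by linarith [h.lt a ha]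
    refine fderiv_symm_of_span ((hα.contDiffAt (h.isOpen.mem_nhds ha)).differentiableAt (by simp))
      hd (h.span a ha) ?_ x y
    have e01 : fderiv ℝ (fun y ↦ α y (V 1 y)) a (V 0 a) - fderiv ℝ (fun y ↦ α y (V 0 y)) a (V 1 a)
        = α a (VectorField.lieBracket ℝ (V 0) (V 1) a) := by
      rw [hev hα0 ha, hev hα1 ha, hcomp hP ha, hcomp hQ ha, h.left_zero a ha, h.left_one a ha,
        h.bracket_zero_one a ha]
      simp
    have e02 : fderiv ℝ (fun y ↦ α y (V 2 y)) a (V 0 a) - fderiv ℝ (fun y ↦ α y (V 0 y)) a (V 2 a)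
        = α a (VectorField.lieBracket ℝ (V 0) (V 2) a) := by
      rw [hev hα0 ha, hev hα2 ha, hcomp hP ha, h.left_two a ha, VectorField.lieBracket_swap,
        h.bracket_two_zero a ha, map_neg, map_add, map_neg, map_smul, hα0 a ha,
        hα1 a ha, hm a ha]
      simp only [fderiv_fun_const, Pi.zero_apply, zero_apply, smul_eq_mul]
      field_simp
      ring
    have e12 : fderiv ℝ (fun y ↦ α y (V 2 y)) a (V 1 a) - fderiv ℝ (fun y ↦ α y (V 1 y)) a (V 2 a)
        = α a (VectorField.lieBracket ℝ (V 1) (V 2) a) := by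
      rw [hev hα1 ha, hev hα2 ha, hcomp hQ ha, h.left_two a ha, VectorField.lieBracket_swap,
        h.bracket_two_one a ha, map_neg, map_sub, map_smul, hα0 a ha,
        hα1 a ha, hm a ha]
      simp only [fderiv_fun_const, Pi.zero_apply, zero_apply, smul_eq_mul]
      field_simp
      ring
    intro i j hij
    fin_cases i <;> fin_cases j <;> first | exact absurd hij (by decide) | assumption
  refine ⟨w, hws, fun x hx ↦ ?_⟩
  rw [(hw x hx).fderiv]
  exact ⟨hα0 x hx, hα1 x hx, hα2 x hx⟩

end AdaptedCoordinates

end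

/-! ### Normal-form coordinates for an adapted frame -/

section

open Filter Set
open scoped Topology

section AdaptedCoordinates
variable {E : Type*} [NormedAddCommGroup E] [NormedSpace ℝ E]

theorem eq_zero_of_two_by_two {P Q : Fin 2 → ℝ} (hdet : P 0 * Q 1 - P 1 * Q 0 ≠ 0) {A B : ℝ}
    (h : ∀ i, P i * A + Q i * B = 0) : A = 0 ∧ B = 0 := by
  constructor
  · refine (mul_eq_zero.1 (?_ : (P 0 * Q 1 - P 1 * Q 0) * A = 0)).resolve_left hdet
    linear_combination Q 1 * h 0 - Q 0 * h 1
  · refine (mul_eq_zero.1 (?_ : (P 0 * Q 1 - P 1 * Q 0) * B = 0)).resolve_left hdet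
    linear_combination P 0 * h 1 - P 1 * h 0

/-- Coordinate functions along the leaves `K = const` on which an adapted frame takes its normal
form. -/
theorem IsAdaptedFrame.exists_leaf_coordinates [CompleteSpace E] {V : Fin 3 → E → E} {K μ : E → ℝ}
    {U : Set E} (h : IsAdaptedFrame V K μ U) {p : E} (hp : p ∈ U) :
    ∃ (U' : Set E) (m : ℝ → ℝ) (J : Set ℝ) (X Y : E → ℝ), IsOpen U' ∧ p ∈ U' ∧ U' ⊆ U ∧
      ContDiffOn ℝ ∞ m J ∧ ContDiffOn ℝ ∞ X U' ∧ ContDiffOn ℝ ∞ Y U' ∧ ∀ x ∈ U', K x ∈ J ∧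
        μ x = m (K x) ∧ fderiv ℝ X x (V 0 x) = 1 ∧ fderiv ℝ Y x (V 0 x) = 0 ∧
        fderiv ℝ X x (V 1 x) = 0 ∧ fderiv ℝ Y x (V 1 x) = 1 ∧
        fderiv ℝ X x (V 2 x) = X x - (√(-1 - K x) + μ x / 2) * Y x ∧
        fderiv ℝ Y x (V 2 x) = Y x - (√(-1 - K x) - μ x / 2) * X x := by
  obtain ⟨m, ε, hε, hm, hev⟩ := h.exists_factor hp
  let s := Ioo (K p - ε) (K p + ε) ∩ Iio (-1)
  have hs : IsOpen s := isOpen_Ioo.inter isOpen_Iio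
  have hms : ContDiffOn ℝ ∞ m s := hm.mono inter_subset_left
  have hsqrt : ContDiffOn ℝ ∞ (fun t : ℝ ↦ √(-1 - t)) s :=
    (contDiffOn_const.sub contDiffOn_id).sqrt fun t ht ↦ by
      have : t < -1 := ht.2
      have : 0 < -1 - t := by linarith
      exact this.ne'
  have hinv : ContDiffOn ℝ ∞ (fun t : ℝ ↦ (4 * (t + 1))⁻¹) s :=
    (contDiffOn_const.mul (contDiffOn_id.add contDiffOn_const)).inv fun t ht ↦ by
      have : t < -1 := ht.2
      have : 4 * (t + 1) < 0 := by linarith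
      exact this.ne
  obtain ⟨P, Q, J, hJ, hpJ, hJs, hPs, hQs, hP, hQ, hdet⟩ := exists_fundamental_solution hs
    (t₀ := K p) ⟨by constructor <;> linarith, h.lt p hp⟩ hinv
    (b := fun t ↦ -(√(-1 - t) - m t / 2) * (4 * (t + 1))⁻¹)
    (c := fun t ↦ -(√(-1 - t) + m t / 2) * (4 * (t + 1))⁻¹)
    ((hsqrt.sub (hms.div_const 2)).neg.mul hinv) ((hsqrt.add (hms.div_const 2)).neg.mul hinv)
  have hKc : ContinuousAt K p := (h.smooth_left.continuousOn).continuousAt (h.isOpen.mem_nhds hp)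
  obtain ⟨r, hr, hball⟩ := Metric.eventually_nhds_iff_ball.1
    ((hev.and (hKc.eventually_mem (hJ.mem_nhds hpJ))).and (h.isOpen.mem_nhds hp))
  -- A ball is taken because the Poincaré lemma needs a convex domain.
  let U' := Metric.ball p r
  have hU'U : U' ⊆ U := fun x hx ↦ (hball x hx).2
  have hKJ : MapsTo K U' J := fun x hx ↦ (hball x hx).1.2
  have hμm (x : E) (hx : x ∈ U') : μ x = m (K x) := (hball x hx).1.1.2
  have h' := h.mono (Metric.isOpen_ball : IsOpen U') hU'U
  have hprim (i : Fin 2) := h'.exists_primitive (convex_ball p r) hKJ hμm (hPs i) (hQs i) (hP i)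
    (hQ i)
  choose w hws hw using hprim
  have hPK (i : Fin 2) : ContDiffOn ℝ ∞ (fun x ↦ P i (K x)) U' := (hPs i).comp h'.smooth_left hKJ
  have hQK (i : Fin 2) : ContDiffOn ℝ ∞ (fun x ↦ Q i (K x)) U' := (hQs i).comp h'.smooth_left hKJ
  let Δ : E → ℝ := fun x ↦ P 0 (K x) * Q 1 (K x) - P 1 (K x) * Q 0 (K x)
  have hΔ (x : E) (hx : x ∈ U') : Δ x ≠ 0 := hdet _ (hKJ hx)
  have hΔs : ContDiffOn ℝ ∞ Δ U' := ((hPK 0).mul (hQK 1)).sub ((hPK 1).mul (hQK 0))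
  -- Cramer's rule for `Pᵢ X + Qᵢ Y = wᵢ`.
  let X : E → ℝ := fun x ↦ (Q 1 (K x) * w 0 x - Q 0 (K x) * w 1 x) / Δ x
  let Y : E → ℝ := fun x ↦ (P 0 (K x) * w 1 x - P 1 (K x) * w 0 x) / Δ x
  have hX : ContDiffOn ℝ ∞ X U' := (((hQK 1).mul (hws 0)).sub ((hQK 0).mul (hws 1))).div hΔs hΔ
  have hY : ContDiffOn ℝ ∞ Y U' := (((hPK 0).mul (hws 1)).sub ((hPK 1).mul (hws 0))).div hΔs hΔ
  have hXY (i : Fin 2) (x : E) (hx : x ∈ U') : P i (K x) * X x + Q i (K x) * Y x = w i x := by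
    have := hΔ x hx
    simp only [X, Y]
    field_simp
    obtain rfl | rfl : i = 0 ∨ i = 1 := by omega
    all_goals simp only [Δ]; ring
  -- This differentiates `Pᵢ X + Qᵢ Y = wᵢ`, replacing `Pᵢ'` and `Qᵢ'` by the right-hand sides of
  -- the ODE.
  have hder (i : Fin 2) (x : E) (hx : x ∈ U') (v : E) :
      P i (K x) * fderiv ℝ X x v + Q i (K x) * fderiv ℝ Y x v
        + ((4 * (K x + 1))⁻¹ * P i (K x)
          + -(√(-1 - K x) - μ x / 2) * (4 * (K x + 1))⁻¹ * Q i (K x)) * fderiv ℝ K x v * X x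
        + (-(√(-1 - K x) + μ x / 2) * (4 * (K x + 1))⁻¹ * P i (K x)
          + (4 * (K x + 1))⁻¹ * Q i (K x)) * fderiv ℝ K x v * Y x = fderiv ℝ (w i) x v := by
    have hnhds : U' ∈ 𝓝 x := Metric.isOpen_ball.mem_nhds hx
    have hd {f : E → ℝ} (hf : ContDiffOn ℝ ∞ f U') : HasFDerivAt f (fderiv ℝ f x) x :=
      ((hf.contDiffAt hnhds).differentiableAt (by simp)).hasFDerivAt
    have hPd := (hP i _ (hKJ hx)).comp_hasFDerivAt x (hd h'.smooth_left)
    have hQd := (hQ i _ (hKJ hx)).comp_hasFDerivAt x (hd h'.smooth_left)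
    have h1 := (hPd.mul (hd hX)).add (hQd.mul (hd hY))
    have h2 : (fun x ↦ P i (K x) * X x + Q i (K x) * Y x) =ᶠ[𝓝 x] w i := by
      filter_upwards [hnhds] with y hy using hXY i y hy
    have h3 : fderiv ℝ (fun x ↦ P i (K x) * X x + Q i (K x) * Y x) x = _ := h1.fderiv
    rw [← h2.fderiv_eq, h3, hμm x hx]
    simp only [add_apply, smul_apply, smul_eq_mul, Function.comp_apply]
    ring
  refine ⟨U', m, J, X, Y, Metric.isOpen_ball, Metric.mem_ball_self hr, hU'U, hms.mono hJs, hX, hY,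
    fun x hx ↦ ⟨hKJ hx, hμm x hx, ?_⟩⟩
  have hne : 4 * (K x + 1) ≠ 0 := by
    have := h'.lt x hx
    intro h0
    linarith
  have r0 := eq_zero_of_two_by_two (P := fun i ↦ P i (K x)) (Q := fun i ↦ Q i (K x)) (hΔ x hx)
    (A := fderiv ℝ X x (V 0 x) - 1) (B := fderiv ℝ Y x (V 0 x)) fun i ↦ by
      have := hder i x hx (V 0 x)
      rw [h'.left_zero x hx, (hw i x hx).1] at this
      linear_combination this
  have r1 := eq_zero_of_two_by_two (P := fun i ↦ P i (K x)) (Q := fun i ↦ Q i (K x)) (hΔ x hx)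
    (A := fderiv ℝ X x (V 1 x)) (B := fderiv ℝ Y x (V 1 x) - 1) fun i ↦ by
      have := hder i x hx (V 1 x)
      rw [h'.left_one x hx, (hw i x hx).2.1] at this
      linear_combination this
  -- Along `V 2` the `wᵢ` are constant and `dK = -4(K + 1)` cancels the denominators of the ODE,
  -- leaving a homogeneous system for the defects of the two claimed formulas.
  have r2 := eq_zero_of_two_by_two (P := fun i ↦ P i (K x)) (Q := fun i ↦ Q i (K x)) (hΔ x hx)
    (A := fderiv ℝ X x (V 2 x) - (X x - (√(-1 - K x) + μ x / 2) * Y x))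
    (B := fderiv ℝ Y x (V 2 x) - (Y x - (√(-1 - K x) - μ x / 2) * X x)) fun i ↦ by
      have := hder i x hx (V 2 x)
      rw [h'.left_two x hx, (hw i x hx).2.2] at this
      have hi : (4 * (K x + 1))⁻¹ * (4 * (K x + 1)) = 1 := inv_mul_cancel₀ hne
      linear_combination this + hi * (P i (K x) * X x - (√(-1 - K x) - μ x / 2) * Q i (K x) * X x
        - (√(-1 - K x) + μ x / 2) * P i (K x) * Y x + Q i (K x) * Y x)
  exact ⟨by linarith [r0.1], r0.2, r1.1, by linarith [r1.2], by linarith [r2.1],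
    by linarith [r2.2]⟩

/-- Coordinates in which an adapted frame takes its normal form. -/
theorem IsAdaptedFrame.exists_coordinates [CompleteSpace E] {V : Fin 3 → E → E} {K μ : E → ℝ}
    {U : Set E} (h : IsAdaptedFrame V K μ U) {p : E} (hp : p ∈ U) :
    ∃ (e : OpenPartialHomeomorph E (EuclideanSpace ℝ (Fin 3))) (m : ℝ → ℝ),
      p ∈ e.source ∧ e.source ⊆ U ∧ ContDiffOn ℝ ∞ e e.source ∧ ContDiffOn ℝ ∞ e.symm e.target ∧
      ContDiffOn ℝ ∞ m (K '' e.source) ∧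
      ∀ x ∈ e.source, e x 2 = K x ∧ μ x = m (K x) ∧
        fderiv ℝ e x (V 0 x) = EuclideanSpace.single 0 1 ∧
        fderiv ℝ e x (V 1 x) = EuclideanSpace.single 1 1 ∧
        fderiv ℝ e x (V 2 x) =
          (e x 0 - (√(-1 - K x) + μ x / 2) * e x 1) • EuclideanSpace.single 0 1
          + (e x 1 - (√(-1 - K x) - μ x / 2) * e x 0) • EuclideanSpace.single 1 1
          - (4 * (K x + 1)) • EuclideanSpace.single 2 1 := by
  obtain ⟨U', m, J, X, Y, hU', hpU', hU'U, hm, hX, hY, hd⟩ := h.exists_leaf_coordinates hp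
  let Φ : E → EuclideanSpace ℝ (Fin 3) := fun x ↦ !₂[X x, Y x, K x]
  have hΦ : ContDiffOn ℝ ∞ Φ U' := by
    rw [contDiffOn_euclidean]
    intro i
    fin_cases i
    · exact hX
    · exact hY
    · exact h.smooth_left.mono hU'U
  have hΦd (x : E) (hx : x ∈ U') : HasFDerivAt Φ (fderiv ℝ Φ x) x :=
    ((hΦ.contDiffAt (hU'.mem_nhds hx)).differentiableAt (by simp)).hasFDerivAt
  have hΦi (x : E) (hx : x ∈ U') (v : E) (i : Fin 3) :
      fderiv ℝ Φ x v i = fderiv ℝ (fun y ↦ Φ y i) x v := by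
    have h1 := (EuclideanSpace.proj (𝕜 := ℝ) i).hasFDerivAt.comp x (hΦd x hx)
    have h2 : fderiv ℝ (fun y ↦ Φ y i) x = _ := h1.fderiv
    rw [h2]
    rfl
  have hext (x : E) (hx : x ∈ U') (v : E) :
      fderiv ℝ Φ x v = fderiv ℝ X x v • EuclideanSpace.single 0 1
        + fderiv ℝ Y x v • EuclideanSpace.single 1 1
        + fderiv ℝ K x v • EuclideanSpace.single 2 1 := by
    ext i
    rw [hΦi x hx]
    fin_cases i <;> simp [Φ]
  have h0 (x : E) (hx : x ∈ U') : fderiv ℝ Φ x (V 0 x) = EuclideanSpace.single 0 1 := by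
    obtain ⟨-, -, a, b, -⟩ := hd x hx
    rw [hext x hx, a, b, h.left_zero x (hU'U hx)]
    simp
  have h1 (x : E) (hx : x ∈ U') : fderiv ℝ Φ x (V 1 x) = EuclideanSpace.single 1 1 := by
    obtain ⟨-, -, -, -, a, b, -⟩ := hd x hx
    rw [hext x hx, a, b, h.left_one x (hU'U hx)]
    simp
  have h2 (x : E) (hx : x ∈ U') : fderiv ℝ Φ x (V 2 x) =
      (X x - (√(-1 - K x) + μ x / 2) * Y x) • EuclideanSpace.single 0 1
        + (Y x - (√(-1 - K x) - μ x / 2) * X x) • EuclideanSpace.single 1 1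
        - (4 * (K x + 1)) • EuclideanSpace.single 2 1 := by
    obtain ⟨-, -, -, -, -, -, a, b⟩ := hd x hx
    rw [hext x hx, a, b, h.left_two x (hU'U hx), neg_smul, sub_eq_add_neg _ ((4 * (K x + 1)) • _)]
  have hne : 4 * (K p + 1) ≠ 0 := by
    have := h.lt p hp
    intro h0
    linarith
  have hinj (c : Fin 3 → ℝ) (hc : fderiv ℝ Φ p (∑ i, c i • V i p) = 0) : c = 0 := by
    simp only [Fin.sum_univ_three, map_add, map_smul, h0 p hpU', h1 p hpU', h2 p hpU'] at hc
    have c2 := congrArg (fun v : EuclideanSpace ℝ (Fin 3) ↦ v 2) hc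
    have c0 := congrArg (fun v : EuclideanSpace ℝ (Fin 3) ↦ v 0) hc
    have c1 := congrArg (fun v : EuclideanSpace ℝ (Fin 3) ↦ v 1) hc
    simp at c0 c1 c2
    have e2 : c 2 = 0 := c2.resolve_right fun h0 ↦ by simp [h0] at hne
    rw [e2] at c0 c1
    ext i
    fin_cases i
    · simpa using c0
    · simpa using c1
    · exact e2
  have hbij : Function.Bijective (fderiv ℝ Φ p) := by
    refine ⟨(injective_iff_map_eq_zero _).2 fun v hv ↦ ?_, fun y ↦ ?_⟩
    · obtain ⟨c, rfl⟩ := h.span p hp v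
      simp [hinj c hv]
    -- The preimage comes from back substitution: the third coordinate fixes the coefficient of `V
    -- 2`, and the other two are corrected accordingly.
    · refine ⟨(y 0 + y 2 / (4 * (K p + 1)) * (X p - (√(-1 - K p) + μ p / 2) * Y p)) • V 0 p
        + (y 1 + y 2 / (4 * (K p + 1)) * (Y p - (√(-1 - K p) - μ p / 2) * X p)) • V 1 p
        - (y 2 / (4 * (K p + 1))) • V 2 p, ?_⟩
      simp only [map_add, map_sub, map_smul, h0 p hpU', h1 p hpU', h2 p hpU']
      ext i
      fin_cases i
      · simp
      · simp
      · simpa using div_mul_cancel₀ (y 2) hne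
  let L : E ≃L[ℝ] EuclideanSpace ℝ (Fin 3) := ContinuousLinearEquiv.ofBijective (fderiv ℝ Φ p)
    (LinearMap.ker_eq_bot.2 hbij.1) (LinearMap.range_eq_top.2 hbij.2)
  have hL : (L : E →L[ℝ] EuclideanSpace ℝ (Fin 3)) = fderiv ℝ Φ p := by ext1; rfl
  obtain ⟨e, hpe, heU', he, hes⟩ := exists_openPartialHomeomorph_contDiffOn_symm hU' hpU' hΦ
    (hL ▸ hΦd p hpU')
  have heq : (e : E → EuclideanSpace ℝ (Fin 3)) = Φ := funext he
  refine ⟨e, m, hpe, heU'.trans hU'U, heq ▸ hΦ.mono heU', hes, hm.mono ?_, fun x hx ↦ ?_⟩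
  · rintro _ ⟨x, hx, rfl⟩
    exact (hd x (heU' hx)).1
  · rw [heq]
    exact ⟨rfl, (hd x (heU' hx)).2.1, h0 x (heU' hx), h1 x (heU' hx), h2 x (heU' hx)⟩

end AdaptedCoordinates

end

/-! ### Transfer from a chart to the manifold -/

section Transfer
open Filter Topology Set

variable {M : Type*} [TopologicalSpace M] [ChartedSpace (EuclideanSpace ℝ (Fin 3)) M]
  [IsManifold (𝓡 3) ∞ M]

/-- A frame on a `3`-manifold satisfying the structure equations of a generalized
`(k, μ)`-manifold is the coordinate expression of an adapted chart. -/
theorem exists_adapted_chart {W : Fin 3 → Π x : M, TangentSpace (𝓡 3) x} {K μ : M → ℝ} {U : Set M}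
    (hU : IsOpen U) {p : M} (hp : p ∈ U) (hW : ∀ i, ∀ q ∈ U, SmoothAt (W i) q)
    (hK : ContMDiff (𝓡 3) 𝓘(ℝ, ℝ) ∞ K) (hμ : ContMDiff (𝓡 3) 𝓘(ℝ, ℝ) ∞ μ)
    (hli : ∀ q ∈ U, LinearIndependent ℝ fun i ↦ W i q) (hlt : ∀ q ∈ U, K q < -1)
    (hb01 : ∀ q ∈ U, mlieBracket (𝓡 3) (W 0) (W 1) q = 0)
    (hb20 : ∀ q ∈ U, mlieBracket (𝓡 3) (W 2) (W 0) q =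
      -W 0 q + (√(-1 - K q) - μ q / 2) • W 1 q)
    (hb21 : ∀ q ∈ U, mlieBracket (𝓡 3) (W 2) (W 1) q =
      (√(-1 - K q) + μ q / 2) • W 0 q - W 1 q)
    (hK0 : ∀ q ∈ U, mvfderiv (𝓡 3) K q (W 0 q) = 0)
    (hK1 : ∀ q ∈ U, mvfderiv (𝓡 3) K q (W 1 q) = 0)
    (hK2 : ∀ q ∈ U, mvfderiv (𝓡 3) K q (W 2 q) = -(4 * (K q + 1)))
    (hμ0 : ∀ q ∈ U, mvfderiv (𝓡 3) μ q (W 0 q) = 0)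
    (hμ1 : ∀ q ∈ U, mvfderiv (𝓡 3) μ q (W 1 q) = 0) :
    ∃ (e : OpenPartialHomeomorph M (EuclideanSpace ℝ (Fin 3))) (m : ℝ → ℝ),
      e ∈ IsManifold.maximalAtlas (𝓡 3) ∞ M ∧ p ∈ e.source ∧ e.source ⊆ U ∧
      ContDiffOn ℝ ∞ m (K '' e.source) ∧
      ∀ q ∈ e.source, e q 2 = K q ∧ μ q = m (K q) ∧
        W 0 q = coordField e 0 q ∧ W 1 q = coordField e 1 q ∧
        W 2 q = (e q 0 - (√(-1 - K q) + μ q / 2) * e q 1) • coordField e 0 q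
          + (e q 1 - (√(-1 - K q) - μ q / 2) * e q 0) • coordField e 1 q
          - (4 * (K q + 1)) • coordField e 2 q := by
  let c := chartAt (EuclideanSpace ℝ (Fin 3)) p
  have hc : c.MDifferentiable (𝓡 3) (𝓡 3) := by
    have : IsManifold (𝓡 3) 1 M := IsManifold.of_le (n := ∞) (by simp)
    exact mdifferentiable_chart p
  have hcs : ContMDiffOn (𝓡 3) (𝓡 3) ∞ c.symm c.target := contMDiffOn_chart_symm
  have hcsAt {y : EuclideanSpace ℝ (Fin 3)} (hy : y ∈ c.target) :
      ContMDiffAt (𝓡 3) (𝓡 3) ∞ c.symm y := hcs.contMDiffAt (c.open_target.mem_nhds hy)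
  let V : Fin 3 → EuclideanSpace ℝ (Fin 3) → EuclideanSpace ℝ (Fin 3) :=
    fun i ↦ mpullback (𝓡 3) (𝓡 3) c.symm (W i)
  let Ω : Set (EuclideanSpace ℝ (Fin 3)) := c.target ∩ c.symm ⁻¹' U
  let S (y : EuclideanSpace ℝ (Fin 3)) :
      EuclideanSpace ℝ (Fin 3) →L[ℝ] TangentSpace (𝓡 3) (c.symm y) :=
    mfderiv (𝓡 3) (𝓡 3) c.symm y
  have hinv {y : EuclideanSpace ℝ (Fin 3)} (hy : y ∈ c.target) :
      (mfderiv (𝓡 3) (𝓡 3) c.symm y).IsInvertible := ⟨hc.symm.mfderiv hy, rfl⟩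
  have hS {y : EuclideanSpace ℝ (Fin 3)} (hy : y ∈ c.target)
      (Z : Π x : M, TangentSpace (𝓡 3) x) :
      S y (mpullback (𝓡 3) (𝓡 3) c.symm Z y) = Z (c.symm y) := by
    obtain ⟨T, hT⟩ := hinv hy
    simp only [S, mpullback_apply]
    rw [← hT, ContinuousLinearMap.inverse_equiv]
    exact T.apply_symm_apply _
  have hSV {y : EuclideanSpace ℝ (Fin 3)} (hy : y ∈ c.target) (i : Fin 3) :
      S y (V i y) = W i (c.symm y) := hS hy (W i)
  have hSinj {y : EuclideanSpace ℝ (Fin 3)} (hy : y ∈ c.target) : Function.Injective (S y) :=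
    (hc.symm.mfderiv hy).injective
  have hbr {y : EuclideanSpace ℝ (Fin 3)} (hy : y ∈ Ω) (i j : Fin 3) :
      S y (lieBracket ℝ (V i) (V j) y) = mlieBracket (𝓡 3) (W i) (W j) (c.symm y) := by
    have h2 : minSmoothness ℝ 2 ≤ (∞ : ℕ∞ω) := by
      rw [minSmoothness_of_isRCLikeNormedField]
      exact WithTop.coe_le_coe.2 (le_top : (2 : ℕ∞) ≤ ⊤)
    have h3 : minSmoothness ℝ 3 ≤ (∞ : ℕ∞ω) := by
      rw [minSmoothness_of_isRCLikeNormedField]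
      exact WithTop.coe_le_coe.2 (le_top : (3 : ℕ∞) ≤ ⊤)
    have : IsManifold (𝓡 3) (minSmoothness ℝ 2) M := IsManifold.of_le h2
    have : IsManifold (𝓡 3) (minSmoothness ℝ 3) M := IsManifold.of_le h3
    have h4 := mpullback_mlieBracket (hW i _ hy.2).mdiff (hW j _ hy.2).mdiff (hcsAt hy.1) h2
    have h5 : mlieBracket (𝓡 3) (V i) (V j) y = lieBracket ℝ (V i) (V j) y := by
      rw [← mlieBracketWithin_univ, mlieBracketWithin_eq_lieBracketWithin]
      exact congrFun (lieBracketWithin_univ (V := V i) (W := V j)) y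
    exact (congrArg (S y) (h4.trans h5)).symm.trans (hS hy.1 _)
  have hfd {f : M → ℝ} (hf : ContMDiff (𝓡 3) 𝓘(ℝ, ℝ) ∞ f) {y : EuclideanSpace ℝ (Fin 3)}
      (hy : y ∈ Ω) (i : Fin 3) :
      fderiv ℝ (f ∘ c.symm) y (V i y) = mvfderiv (𝓡 3) f (c.symm y) (W i (c.symm y)) := by
    rw [← hSV hy.1]
    refine Eq.trans ?_ (mvfderiv_comp_apply y ((hf _).mdifferentiableAt (by simp))
      ((hcsAt hy.1).mdifferentiableAt (by simp)) (V i y))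
    rw [mvfderiv, mfderiv_eq_fderiv]
    rfl
  have hfs {f : M → ℝ} (hf : ContMDiff (𝓡 3) 𝓘(ℝ, ℝ) ∞ f) : ContDiffOn ℝ ∞ (f ∘ c.symm) Ω :=
    (hf.comp_contMDiffOn (hcs.mono inter_subset_left)).contDiffOn
  have hV : ∀ i, ContDiffOn ℝ ∞ (V i) Ω := fun i ↦
    contMDiffOn_vectorSpace_iff_contDiffOn.1 fun y hy ↦
      (ContMDiffAt.mpullback_vectorField_preimage (hW i _ hy.2) (hcsAt hy.1) (hinv hy.1)
        (by simp)).contMDiffWithinAt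
  have hVli : ∀ y ∈ Ω, LinearIndependent ℝ fun i ↦ V i y := fun y hy ↦
    LinearIndependent.of_comp (S y).toLinearMap (by
      convert! hli _ hy.2 using 2 with i
      exact hSV hy.1 i)
  have hframe : IsAdaptedFrame V (K ∘ c.symm) (μ ∘ c.symm) Ω :=
    { isOpen := c.symm.isOpen_inter_preimage hU
      smooth := hV
      smooth_left := hfs hK
      smooth_right := hfs hμ
      linearIndependent := hVli
      span := fun y hy v ↦ by
        let B := basisOfLinearIndependentOfCardEqFinrank (hVli y hy) (by simp)
        refine ⟨B.repr v, ?_⟩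
        conv_lhs => rw [← B.sum_repr v]
        simp [B]
      lt := fun y hy ↦ hlt _ hy.2
      bracket_zero_one := fun y hy ↦ hSinj hy.1 (by rw [hbr hy, hb01 _ hy.2, map_zero])
      bracket_two_zero := fun y hy ↦ hSinj hy.1 (by
        rw [hbr hy, hb20 _ hy.2, map_add, map_neg, map_smul, hSV hy.1, hSV hy.1]
        rfl)
      bracket_two_one := fun y hy ↦ hSinj hy.1 (by
        rw [hbr hy, hb21 _ hy.2, map_sub, map_smul, hSV hy.1, hSV hy.1]
        rfl)
      left_zero := fun y hy ↦ (hfd hK hy 0).trans (hK0 _ hy.2)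
      left_one := fun y hy ↦ (hfd hK hy 1).trans (hK1 _ hy.2)
      left_two := fun y hy ↦ (hfd hK hy 2).trans (hK2 _ hy.2)
      right_zero := fun y hy ↦ (hfd hμ hy 0).trans (hμ0 _ hy.2)
      right_one := fun y hy ↦ (hfd hμ hy 1).trans (hμ1 _ hy.2) }
  have hpc : p ∈ c.source := mem_chart_source _ p
  obtain ⟨e, m, hpe, heΩ, hes, hess, hm, he⟩ := hframe.exists_coordinates (p := c p)
    ⟨c.map_source hpc, by simpa [c.left_inv hpc] using hp⟩
  have hsrc {q : M} (hq : q ∈ (c ≫ₕ e).source) : q ∈ c.source ∧ c q ∈ e.source := by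
    simpa using hq
  have hcM : ContMDiffOn (𝓡 3) (𝓡 3) ∞ c c.source := contMDiffOn_chart
  have hmax : (c ≫ₕ e) ∈ IsManifold.maximalAtlas (𝓡 3) ∞ M := by
    refine OpenPartialHomeomorph.mem_maximalAtlas_of_contMDiffOn _ ?_ ?_
    · exact hes.contMDiffOn.comp (hcM.mono fun q hq ↦ (hsrc hq).1) fun q hq ↦ (hsrc hq).2
    · refine hcs.comp (hess.contMDiffOn.mono fun y hy ↦ ?_) fun y hy ↦ ?_
      · rw [OpenPartialHomeomorph.trans_target] at hy
        exact hy.1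
      · rw [OpenPartialHomeomorph.trans_target] at hy
        exact hy.2
  let T (q : M) : EuclideanSpace ℝ (Fin 3) →L[ℝ] TangentSpace (𝓡 3) q :=
    mfderiv (𝓡 3) (𝓡 3) (c ≫ₕ e).symm ((c ≫ₕ e) q)
  have hT (q : M) (i : Fin 3) : coordField (c ≫ₕ e) i q = T q (EuclideanSpace.single i 1) := rfl
  -- Chain rule for `(c ≫ₕ e).symm ∘ e = c.symm`: coordinate fields of the composite chart are
  -- compared with the fields pulled back by `c.symm`.
  have hcoord {q : M} (hq : q ∈ (c ≫ₕ e).source) (v : EuclideanSpace ℝ (Fin 3)) :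
      T q (fderiv ℝ e (c q) v) = S (c q) v := by
    have hnhds := e.open_source.mem_nhds (hsrc hq).2
    have h1 : (c ≫ₕ e).symm ∘ e =ᶠ[𝓝 (c q)] c.symm := by
      filter_upwards [hnhds] with y hy
      simp [e.left_inv hy]
    have h2 : MDifferentiableAt (𝓡 3) (𝓡 3) (c ≫ₕ e).symm (e (c q)) :=
      ((contMDiffAt_symm_of_mem_maximalAtlas hmax ((c ≫ₕ e).map_source hq))).mdifferentiableAt
        (by simp)
    have h3 : MDifferentiableAt (𝓡 3) (𝓡 3) e (c q) :=
      ((hes.contDiffAt hnhds).differentiableAt (by simp)).mdifferentiableAt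
    have h4 := mfderiv_comp (c q) h2 h3
    rw [h1.mfderiv_eq, mfderiv_eq_fderiv] at h4
    exact (DFunLike.congr_fun h4 v).symm
  refine ⟨c ≫ₕ e, m, hmax, by simpa using ⟨hpc, hpe⟩, fun q hq ↦ ?_, hm.mono ?_, fun q hq ↦ ?_⟩
  · have := (heΩ (hsrc hq).2).2
    rwa [mem_preimage, c.left_inv (hsrc hq).1] at this
  · rintro _ ⟨q, hq, rfl⟩
    exact ⟨c q, (hsrc hq).2, by simp [c.left_inv (hsrc hq).1]⟩
  · obtain ⟨h2, hm, d0, d1, d2⟩ := he _ (hsrc hq).2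
    have hqc := c.left_inv (hsrc hq).1
    simp only [Function.comp_apply, hqc] at h2 hm d2
    have hWq (i : Fin 3) : W i q = T q (fderiv ℝ e (c q) (V i (c q))) := by
      -- `c.symm (c q)` equals `q` only propositionally, so the values are compared in the common
      -- model space.
      have h (q' : M) (hq' : q' = q) : (W i q : EuclideanSpace ℝ (Fin 3)) = W i q' := by rw [hq']
      rw [hcoord hq]
      exact (h _ hqc).trans (hSV (c.map_source (hsrc hq).1) i).symm
    refine ⟨h2, hm, ?_, ?_, ?_⟩
    · rw [hWq, d0, hT]
    · rw [hWq, d1, hT]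
    · rw [hWq, d2, map_sub, map_add, map_smul, map_smul, map_smul, hT, hT, hT]
      rfl

end Transfer

end AlmostKenmotsu

end

/-! ### The local normal form -/

theorem theorem4p3 {M : Type*} [TopologicalSpace M]
    [ChartedSpace (EuclideanSpace ℝ (Fin 3)) M] [IsManifold (𝓡 3) ∞ M]
    [RiemannianBundle (fun x : M ↦ TangentSpace (𝓡 3) x)]
    [IsContMDiffRiemannianBundle (𝓡 3) ∞ (EuclideanSpace ℝ (Fin 3))
      (fun x : M ↦ TangentSpace (𝓡 3) x)]
    (φ : Π x : M, TangentSpace (𝓡 3) x →L[ℝ] TangentSpace (𝓡 3) x)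
    (ξ : Π x : M, TangentSpace (𝓡 3) x)
    (η : Π x : M, TangentSpace (𝓡 3) x →L[ℝ] ℝ)
    (k μ : M → ℝ)
    (hM : AlmostKenmotsu.IsAlmostKenmotsu φ ξ η)
    (hkμ : AlmostKenmotsu.IsGeneralizedKMu φ ξ η k μ)
    (hdk : ∀ (x : M) (v w : TangentSpace (𝓡 3) x),
      AlmostKenmotsu.wedgeOneOne (mvfderiv (𝓡 3) k x) (η x) v w = 0)
    (hk : ∀ x, k x < -1)
    (p : M) :
    ∃ (e : OpenPartialHomeomorph M (EuclideanSpace ℝ (Fin 3)))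
      (X : Π x : M, TangentSpace (𝓡 3) x) (m f r : ℝ → ℝ),
      e ∈ IsManifold.maximalAtlas (𝓡 3) ∞ M ∧ p ∈ e.source ∧
      (∀ q ∈ e.source, AlmostKenmotsu.SmoothAt X q) ∧
      -- the functions of `z` are smooth on the set of values of the coordinate `z`
      ContDiffOn ℝ ∞ m ((fun q ↦ e q 2) '' e.source) ∧
      ContDiffOn ℝ ∞ f ((fun q ↦ e q 2) '' e.source) ∧
      ContDiffOn ℝ ∞ r ((fun q ↦ e q 2) '' e.source) ∧
      ∀ q ∈ e.source,
        e q 2 < -1 ∧ k q = e q 2 ∧ μ q = m (e q 2) ∧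
        Orthonormal ℝ ![ξ q, X q, φ q (X q)] ∧
        AlmostKenmotsu.hTensor φ ξ ξ q = 0 ∧
        AlmostKenmotsu.hTensor φ ξ X q = √(-1 - k q) • X q ∧
        AlmostKenmotsu.hTensor φ ξ (fun y ↦ φ y (X y)) q = -√(-1 - k q) • φ q (X q) ∧
        X q = AlmostKenmotsu.coordField e 0 q ∧
        φ q (X q) = AlmostKenmotsu.coordField e 1 q ∧
        ξ q =
          (e q 0 - 1 / 2 * (μ q + 2 * √(-1 - e q 2)) * e q 1 + f (e q 2)) •
              AlmostKenmotsu.coordField e 0 q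
            + (e q 1 + 1 / 2 * (μ q - 2 * √(-1 - e q 2)) * e q 0 + r (e q 2)) •
              AlmostKenmotsu.coordField e 1 q
            - (4 * (e q 2 + 1)) • AlmostKenmotsu.coordField e 2 q := by
  obtain ⟨D, hD, hR⟩ := hkμ.nullity
  have hC := hM.toIsAlmostContactMetric
  obtain ⟨X, U, hpU, hX, hlam⟩ :=
    AlmostKenmotsu.IsUnitHorizontal.exists_eigenframe hM hD hkμ.smooth_k hk hR p
  have hstr := fun q (hq : q ∈ U) ↦ hX.structure_equations hM hD hkμ.smooth_k hk hR hdk hlam hq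
  have hdμ := fun q (hq : q ∈ U) ↦
    hX.mvfderiv_mu_eq_zero hC hkμ.smooth_k hkμ.smooth_mu hk hstr hq
  obtain ⟨e, m, hmax, hpe, heU, hm, he⟩ :=
    AlmostKenmotsu.exists_adapted_chart (W := ![X, AlmostKenmotsu.phiField φ X, ξ]) hX.isOpen hpU
      (by
        intro i q hq
        fin_cases i
        · exact hX.smooth q hq
        · exact hX.smooth_phi hC hq
        · exact hC.smooth_xi q)
      hkμ.smooth_k hkμ.smooth_mu
      (fun q hq ↦ by
        -- The permutation reorders `(ξ, X, φX)` into `(X, φX, ξ)`.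
        have h := (hC.orthonormal (hX.eta q hq) (hX.unit q hq)).linearIndependent.comp
          (![1, 2, 0] : Fin 3 → Fin 3) (by decide)
        convert! h using 1
        ext1 i
        fin_cases i <;> rfl)
      (fun q _ ↦ hk q) (fun q hq ↦ (hstr q hq).2.2.1) (fun q hq ↦ (hstr q hq).1)
      (fun q hq ↦ (hstr q hq).2.1) (fun q hq ↦ (hstr q hq).2.2.2.1)
      (fun q hq ↦ (hstr q hq).2.2.2.2.1) (fun q hq ↦ (hstr q hq).2.2.2.2.2)
      (fun q hq ↦ (hdμ q hq).1) (fun q hq ↦ (hdμ q hq).2)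
  -- The coordinates were built from first integrals of `ξ` by a homogeneous linear system, so no
  -- inhomogeneous terms arise and `f = r = 0`.
  refine ⟨e, X, m, 0, 0, hmax, hpe, fun q hq ↦ hX.smooth q (heU hq), hm.mono ?_, contDiffOn_const,
    contDiffOn_const, fun q hq ↦ ?_⟩
  · rintro _ ⟨q, hq, rfl⟩
    exact ⟨q, hq, (he q hq).1.symm⟩
  · obtain ⟨h2, hμm, d0, d1, d2⟩ := he q hq
    have hqU := heU hq
    refine ⟨h2 ▸ hk q, h2.symm, h2 ▸ hμm, hC.orthonormal (hX.eta q hqU) (hX.unit q hqU),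
      AlmostKenmotsu.IsUnitHorizontal.hTensor_xi hC q, ?_, ?_, d0, d1, ?_⟩
    · rw [hX.hTensor_self hM hqU, (hlam q hqU).1, (hlam q hqU).2, zero_smul, add_zero]
    · have := hX.hTensor_phi hM hqU
      rwa [(hlam q hqU).1, (hlam q hqU).2, zero_smul, zero_sub, ← neg_smul] at this
    · have h3 : ξ q = _ := d2
      rw [h3, h2]
      congr 3
      · simp only [Pi.zero_apply]
        ring
      · simp only [Pi.zero_apply]
        ring
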